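/- Let $\Gamma$ be a nontrivial finite group with identity $\epsilon$ and let $n\ge 3$ be an integer. Let $K_n^{\Gamma}$ be the multigraph with vertex set $[n]=\{1,\dots,n\}$ and edge set $\binom{[n]}{2}\times\Gamma$, where the edge $(\{i,j\},\gamma)$ has ends $i$ and $j$; for $i<j$ this edge has gain $\gamma$ when traversed from $i$ to $j$ and gain $\gamma^{-1}$ when traversed from $j$ to $i$. A cycle of $K_n^{\Gamma}$ (two parallel edges form a cycle) is balanced if the product of the gains of its edges, taken in order along a traversal of the cycle, is $\epsilon$. Let $M(K_n^{\Gamma})$ be the cycle matroid of $K_n^{\Gamma}$. A matroid $L$ is a lift of a matroid $M$ on the same finite ground set $E$ if there are a finite set $F$ disjoint from $E$ and a matroid $K$ on $E\cup F$ with $M=K/F$ and $L=K\setminus F$; the lift is elementary if $r(L)=r(M)+1$. A nontrivial partition of $\Gamma$ is a partition of $\Gamma\setminus\{\epsilon\}$ into at least two nonempty sets such that $A\cup\{\epsilon\}$ is a subgroup of $\Gamma$ for every part $A$. Let $\mathcal{M}_{n,\Gamma}$ be the class of lifts $L$ of $M(K_n^{\Gamma})$ such that a cycle of $K_n^{\Gamma}$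 is a circuit of $L$ if and only if it is balanced. Then $\mathcal{M}_{n,\Gamma}$ contains a non-elementary lift of $M(K_n^{\Gamma})$ if and only if one of the following holds: 1. $n=3$ and $\Gamma$ has a nontrivial partition; 2. $n\ge 4$ and $\Gamma\cong(\mathbb{Z}/p\mathbb{Z})^j$ for some prime $p$ and some integer $j\ge 2$. -/

import Mathlib

open scoped Matroid

namespace LiftMatroid

universe u v

/-! ### Cycles and the cycle matroid of a multigraph -/

section Multigraph

variable {α : Type u} {β : Type v}

/-- The vertices `v 0, …, v m` (pairwise distinct) and the edges `e 0, …, e m` (pairwise distinct)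
are, in this order, those of a cycle of `G`: the edge `e i` joins `v i` to `v (i + 1)`, where indices
are taken modulo `m + 1`.  Loops (`m = 0`) and pairs of parallel edges (`m = 1`) are cycles. -/
structure IsCyclicWalk (G : Graph α β) {m : ℕ} (v : Fin (m + 1) → α) (e : Fin (m + 1) → β) :
    Prop where
  vert_injective : Function.Injective v
  edge_injective : Function.Injective e
  isLink : ∀ i, G.IsLink (e i) (v i) (v (i + 1))

/-- `C` is (the edge set of) a cycle of the multigraph `G`. -/
def IsCycle (G : Graph α β) (C : Set β) : Prop :=
  ∃ (m : ℕ) (v : Fin (m + 1) → α) (e : Fin (m + 1) → β), IsCyclicWalk G v e ∧ C = Set.range e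

/-- A set of edges of `G` that contains no cycle of `G`. -/
def IsAcyclicSet (G : Graph α β) (I : Set β) : Prop :=
  I ⊆ G.edgeSet ∧ ∀ C, C ⊆ I → ¬ IsCycle G C

open Classical in
/-- The incidence vector of an edge over the field with two elements; it is only used to prove the
augmentation property of acyclic sets. -/
noncomputable def incVec (G : Graph α β) (e : β) : α →₀ ZMod 2 :=
  if h : ∃ x y, G.IsLink e x y then
    Finsupp.single h.choose 1 + Finsupp.single h.choose_spec.choose 1
  else 0

theorem incVec_eq {G : Graph α β} {e : β} {x y : α} (h : G.IsLink e x y) :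
    incVec G e = Finsupp.single x 1 + Finsupp.single y 1 := by
  have hex : ∃ x y, G.IsLink e x y := ⟨x, y, h⟩
  rw [incVec, dif_pos hex]
  rcases hex.choose_spec.choose_spec.eq_and_eq_or_eq_and_eq h with ⟨h1, h2⟩ | ⟨h1, h2⟩
  · rw [h2, h1]
  · rw [h2, h1, add_comm]

theorem not_isCycle_of_linearIndepOn {G : Graph α β} {I C : Set β}
    (hI : LinearIndepOn (ZMod 2) (incVec G) I) (hCI : C ⊆ I) : ¬ IsCycle G C := by
  rintro ⟨m, v, e, h, rfl⟩
  have h1 : LinearIndependent (ZMod 2) (fun i : Fin (m + 1) => incVec G (e i)) := by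
    have := hI.mono hCI
    exact (linearIndepOn_range_iff h.edge_injective (incVec G)).1 this
  have h2 : ∑ i : Fin (m + 1), (1 : ZMod 2) • incVec G (e i) = 0 := by
    have h3 : ∀ i, (1 : ZMod 2) • incVec G (e i)
        = Finsupp.single (v i) 1 + Finsupp.single (v (i + 1)) 1 := fun i => by
      rw [one_smul, incVec_eq (h.isLink i)]
    have h4 : ∑ i, Finsupp.single (v (i + 1)) (1 : ZMod 2) = ∑ i, Finsupp.single (v i) 1 :=
      Equiv.sum_comp (Equiv.addRight (1 : Fin (m + 1)))
        (fun i => Finsupp.single (v i) (1 : ZMod 2))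
    rw [Finset.sum_congr rfl (fun i _ => h3 i), Finset.sum_add_distrib, h4]
    ext a
    simp only [Finsupp.add_apply, Finsupp.zero_apply]
    exact CharTwo.add_self_eq_zero _
  exact one_ne_zero (Fintype.linearIndependent_iff.1 h1 (fun _ => 1) h2 0)

theorem exists_isCycle_of_step {G : Graph α β} {D : Set β} (hD : D.Finite) (hne : D.Nonempty)
    (hDE : D ⊆ G.edgeSet)
    (step : ∀ e ∈ D, ∀ x y, G.IsLink e x y → ∃ e' ∈ D, e' ≠ e ∧ ∃ z, G.IsLink e' y z) :
    ∃ C, C ⊆ D ∧ IsCycle G C := by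
  let S := {p : β × α × α // p.1 ∈ D ∧ G.IsLink p.1 p.2.1 p.2.2}
  have hstep : ∀ s : S, ∃ t : S, t.1.1 ≠ s.1.1 ∧ t.1.2.1 = s.1.2.2 := by
    rintro ⟨⟨e, x, y⟩, he, hl⟩
    obtain ⟨e', he', hne', z, hz⟩ := step e he x y hl
    exact ⟨⟨⟨e', y, z⟩, he', hz⟩, hne', rfl⟩
  choose nxt hnxt1 hnxt2 using hstep
  obtain ⟨e₀, he₀⟩ := hne
  obtain ⟨x₀, y₀, hl₀⟩ := G.exists_isLink_of_mem_edgeSet (hDE he₀)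
  let s : ℕ → S := fun k => nxt^[k] ⟨⟨e₀, x₀, y₀⟩, he₀, hl₀⟩
  have hs : ∀ k, s (k + 1) = nxt (s k) := fun k => Function.iterate_succ_apply' _ _ _
  let V : ℕ → α := fun k => (s k).1.2.1
  let F : ℕ → β := fun k => (s k).1.1
  have hFD : ∀ k, F k ∈ D := fun k => (s k).2.1
  have hlink : ∀ k, G.IsLink (F k) (V k) (V (k + 1)) := fun k => by
    have h1 := (s k).2.2
    have h2 : V (k + 1) = (s k).1.2.2 := by
      change (s (k + 1)).1.2.1 = _
      rw [hs, hnxt2]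
    rw [h2]; exact h1
  have hF : ∀ k, F (k + 1) ≠ F k := fun k => by
    change (s (k + 1)).1.1 ≠ _
    rw [hs]; exact hnxt1 _
  have hfin : (⋃ e ∈ D, {x | ∃ y, G.IsLink e x y}).Finite := by
    refine hD.biUnion fun e he => ?_
    obtain ⟨a, b, hab⟩ := G.exists_isLink_of_mem_edgeSet (hDE he)
    refine (Set.toFinite {a, b}).subset ?_
    rintro x ⟨y, hxy⟩
    exact hxy.left_eq_or_eq hab
  have hrep : ∃ d, 0 < d ∧ ∃ a, V a = V (a + d) := by
    obtain ⟨a, b, hab, h⟩ := hfin.exists_lt_map_eq_of_forall_mem (f := V) (fun k => by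
      simp only [Set.mem_iUnion]
      exact ⟨F k, hFD k, V (k + 1), hlink k⟩)
    exact ⟨b - a, by omega, a, by rw [h]; congr 1; omega⟩
  classical
  obtain ⟨hdpos, a, ha⟩ := Nat.find_spec hrep
  have hmin : ∀ i j, i < j → j - i < Nat.find hrep → V i ≠ V j := fun i j hij hlt h =>
    Nat.find_min hrep hlt ⟨by omega, i, by rw [h]; congr 1; omega⟩
  obtain ⟨m, hm⟩ : ∃ m, Nat.find hrep = m + 1 := ⟨Nat.find hrep - 1, by omega⟩
  rw [hm] at ha hmin
  have hFlt : ∀ i j, i < j → j < m + 1 → F (a + i) ≠ F (a + j) := by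
    intro i j hij hj h
    have h1 := hlink (a + i)
    rw [h] at h1
    rcases h1.eq_and_eq_or_eq_and_eq (hlink (a + j)) with ⟨h2, -⟩ | ⟨-, h3⟩
    · exact hmin _ _ (by omega) (by omega) h2
    · by_cases hij' : i + 1 = j
      · subst hij'
        exact hF (a + i) h.symm
      · exact hmin (a + i + 1) (a + j) (by omega) (by omega) h3
  refine ⟨Set.range (fun i : Fin (m + 1) => F (a + i)), ?_, m, fun i => V (a + i),
    fun i => F (a + i), ⟨?_, ?_, ?_⟩, rfl⟩
  · rintro _ ⟨i, rfl⟩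
    exact hFD _
  · intro i j h
    rcases lt_trichotomy i.1 j.1 with hij | hij | hij
    · exact absurd h (hmin _ _ (by omega) (by omega))
    · exact Fin.ext hij
    · exact absurd h.symm (hmin _ _ (by omega) (by omega))
  · intro i j h
    rcases lt_trichotomy i.1 j.1 with hij | hij | hij
    · exact absurd h (hFlt _ _ hij j.2)
    · exact Fin.ext hij
    · exact absurd h.symm (hFlt _ _ hij i.2)
  · intro i
    have h1 := hlink (a + i)
    have h2 : V (a + ((i + 1 : Fin (m + 1)) : ℕ)) = V (a + i + 1) := by
      rcases Nat.lt_or_ge i.1 m with hi | hi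
      · rw [Fin.val_add_one_of_lt (Fin.lt_def.2 (by simpa using hi))]
        rfl
      · have hl : i = Fin.last m := Fin.ext (by simp; omega)
        subst hl
        simpa [add_assoc] using ha
    change G.IsLink (F (a + i)) (V (a + i)) (V (a + ((i + 1 : Fin (m + 1)) : ℕ)))
    rw [h2]; exact h1

theorem IsAcyclicSet.linearIndepOn {G : Graph α β} {I : Set β} (hI : IsAcyclicSet G I) :
    LinearIndepOn (ZMod 2) (incVec G) I := by
  classical
  by_contra hcon
  rw [linearIndepOn_iff'] at hcon
  push Not at hcon
  obtain ⟨t, g, htI, hsum, e₀, he₀, hge₀⟩ := hcon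
  let D : Finset β := t.filter (fun e => g e ≠ 0)
  have hDI : (D : Set β) ⊆ I := fun e he => htI (by
    simp only [D, Finset.coe_filter] at he
    exact he.1)
  have hsumD : ∑ e ∈ D, incVec G e = 0 := by
    rw [← hsum, Finset.sum_filter]
    refine Finset.sum_congr rfl fun e _ => ?_
    have : ∀ c : ZMod 2, c = 0 ∨ c = 1 := by decide
    rcases this (g e) with h | h <;> simp [h]
  have hloop : ∀ e ∈ D, ∀ x, ¬ G.IsLink e x x := fun e he x hl =>
    hI.2 {e} (by simpa using hDI he) ⟨0, fun _ => x, fun _ => e,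
      ⟨fun i j _ => Fin.ext (by omega), fun i j _ => Fin.ext (by omega), fun _ => hl⟩,
      by simp⟩
  obtain ⟨C, hCD, hC⟩ := exists_isCycle_of_step (G := G) (D := D) D.finite_toSet
    ⟨e₀, by simp [D, he₀, hge₀]⟩ (hDI.trans hI.1) (by
      intro e he x y hl
      by_contra hno
      push Not at hno
      have hxy : x ≠ y := by
        rintro rfl
        exact hloop e he x hl
      have h1 : (∑ e ∈ D, incVec G e) y = 0 := by rw [hsumD]; rfl
      rw [Finsupp.finsetSum_apply, Finset.sum_eq_single_of_mem e he] at h1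
      · rw [incVec_eq hl] at h1
        simp [hxy] at h1
      · intro e' he' hne
        obtain ⟨a, b, hab⟩ := G.exists_isLink_of_mem_edgeSet (hI.1 (hDI he'))
        have ha : a ≠ y := by
          rintro rfl
          exact hno e' he' hne _ hab
        have hb : b ≠ y := by
          rintro rfl
          exact hno e' he' hne _ hab.symm
        rw [incVec_eq hab]
        simp [ha, hb])
  exact hI.2 C (hCD.trans hDI) hC

theorem IsAcyclicSet.augment {G : Graph α β} {I J : Set β} (hI : IsAcyclicSet G I)
    (hIfin : I.Finite) (hJ : IsAcyclicSet G J) (hJfin : J.Finite) (hlt : I.ncard < J.ncard) :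
    ∃ e ∈ J, e ∉ I ∧ IsAcyclicSet G (insert e I) := by
  have hIl := hI.linearIndepOn
  have hJl := hJ.linearIndepOn
  obtain ⟨e, heJ, he⟩ : ∃ e ∈ J, incVec G e ∉ Submodule.span (ZMod 2) (incVec G '' I) := by
    by_contra hcon
    push Not at hcon
    have hle : Submodule.span (ZMod 2) (incVec G '' J) ≤ Submodule.span (ZMod 2) (incVec G '' I) :=
      Submodule.span_le.2 (by
        rintro _ ⟨e, he, rfl⟩
        exact hcon e he)
    have hrank : ∀ K : Set β, K.Finite → LinearIndepOn (ZMod 2) (incVec G) K →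
        Module.finrank (ZMod 2) (Submodule.span (ZMod 2) (incVec G '' K)) = K.ncard := by
      intro K hK hKl
      have := hK.fintype
      have h1 := finrank_span_eq_card (R := ZMod 2) (b := fun i : K => incVec G i) hKl
      rw [Set.image_eq_range, h1, ← Nat.card_eq_fintype_card, Nat.card_coe_set_eq]
    have : Module.Finite (ZMod 2) (Submodule.span (ZMod 2) (incVec G '' I)) :=
      FiniteDimensional.span_of_finite _ (hIfin.image _)
    have h2 := Submodule.finrank_mono hle
    rw [hrank I hIfin hIl, hrank J hJfin hJl] at h2
    omega
  have heI : e ∉ I := fun h => he (Submodule.subset_span ⟨e, h, rfl⟩)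
  refine ⟨e, heJ, heI, Set.insert_subset (hJ.1 heJ) hI.1, fun C hC => ?_⟩
  exact not_isCycle_of_linearIndepOn ((linearIndepOn_insert heI).2 ⟨hIl, he⟩) hC

/-- The cycle matroid `M(G)` of a multigraph `G`: its ground set is the edge set of `G`, and its
independent sets are the sets of edges that contain no cycle of `G`. -/
def cycleMatroid (G : Graph α β) : Matroid β :=
  (IndepMatroid.ofFinitaryCardAugment
    (E := G.edgeSet)
    (Indep := IsAcyclicSet G)
    (indep_empty := ⟨Set.empty_subset _, fun C hC => by
      rintro ⟨m, v, e, -, rfl⟩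
      exact hC (Set.mem_range_self 0)⟩)
    (indep_subset := fun _ _ hJ hIJ => ⟨hIJ.trans hJ.1, fun C hC => hJ.2 C (hC.trans hIJ)⟩)
    (indep_aug := fun _ _ hI hIfin hJ hJfin hlt => hI.augment hIfin hJ hJfin hlt)
    (indep_compact := fun I h => ⟨fun e he =>
        (h {e} (Set.singleton_subset_iff.2 he) (Set.finite_singleton e)).1 rfl, by
      rintro C hC ⟨m, v, e, hw, rfl⟩
      exact (h _ hC (Set.finite_range e)).2 _ subset_rfl ⟨m, v, e, hw, rfl⟩⟩)
    (subset_ground := fun _ hI => hI.1)).matroid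

@[simp] theorem cycleMatroid_ground (G : Graph α β) : (cycleMatroid G).E = G.edgeSet := rfl

@[simp] theorem cycleMatroid_indep_iff (G : Graph α β) {I : Set β} :
    (cycleMatroid G).Indep I ↔ IsAcyclicSet G I := Iff.rfl

end Multigraph

/-! ### Lifts of matroids -/

section Lift

variable {β : Type v}

/-- `L` is a lift of `M`: there are a finite set `F` disjoint from the common ground set `E` of `L`
and `M`, and a matroid `K` on `E ∪ F`, such that `M = K / F` and `L = K \ F`. The set `E ∪ F` is
realised inside the disjoint union `β ⊕ Fin k`, with `F` the whole second summand. -/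
def IsLift (L M : Matroid β) : Prop :=
  ∃ (k : ℕ) (K : Matroid (β ⊕ Fin k)),
    Set.range Sum.inr ⊆ K.E ∧
    M.mapEmbedding Function.Embedding.inl = K ／ Set.range Sum.inr ∧
    L.mapEmbedding Function.Embedding.inl = K ＼ Set.range Sum.inr

/-- `L` is an elementary lift of `M`: it is a lift of `M` whose rank is one more than that of `M`. -/
def IsElementaryLift (L M : Matroid β) : Prop :=
  IsLift L M ∧ L.eRank = M.eRank + 1

end Lift

/-! ### The full gain graph of a group -/

section Gain

/-- The edges of `K_n^Γ`: pairs consisting of a two-element subset of the vertex set, written as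
`(i, j)` with `i < j`, and an element of `Γ`. -/
abbrev GainEdge (n : ℕ) (Γ : Type u) : Type u :=
  {p : Fin n × Fin n // p.1 < p.2} × Γ

/-- The multigraph `K_n^Γ`, where the edge `({i, j}, γ)` has ends `i` and `j`. -/
def fullGainGraph (n : ℕ) (Γ : Type u) : Graph (Fin n) (GainEdge n Γ) where
  vertexSet := Set.univ
  IsLink e x y := (x = e.1.1.1 ∧ y = e.1.1.2) ∨ (x = e.1.1.2 ∧ y = e.1.1.1)
  edgeSet := Set.univ
  isLink_symm := fun _ _ => ⟨fun _ _ h => by tauto⟩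
  eq_or_eq_of_isLink_of_isLink := by
    rintro e x y v w (⟨rfl, rfl⟩ | ⟨rfl, rfl⟩) (⟨rfl, rfl⟩ | ⟨rfl, rfl⟩) <;> simp
  edge_mem_iff_exists_isLink := fun e =>
    ⟨fun _ => ⟨e.1.1.1, e.1.1.2, Or.inl ⟨rfl, rfl⟩⟩, fun _ => Set.mem_univ e⟩
  left_mem_of_isLink := fun _ _ _ _ => Set.mem_univ _

/-- The gain of the edge `({i, j}, γ)`, `i < j`, when it is traversed starting from its end `x`:
it is `γ` from `i` to `j`, and `γ⁻¹` from `j` to `i`. -/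
def gainFrom {n : ℕ} {Γ : Type u} [Group Γ] (e : GainEdge n Γ) (x : Fin n) : Γ :=
  if x = e.1.1.1 then e.2 else e.2⁻¹

/-- `C` is a balanced cycle of `K_n^Γ`: the product of the gains along some traversal of the cycle
is the identity. (Other starting points and the other direction change the product only by
conjugation and inversion.) -/
def IsBalancedCycle {n : ℕ} {Γ : Type u} [Group Γ] (C : Set (GainEdge n Γ)) : Prop :=
  ∃ (m : ℕ) (v : Fin (m + 1) → Fin n) (e : Fin (m + 1) → GainEdge n Γ),
    IsCyclicWalk (fullGainGraph n Γ) v e ∧ C = Set.range e ∧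
      (List.ofFn fun i => gainFrom (e i) (v i)).prod = 1

/-- The class of lifts `L` of `M(K_n^Γ)` such that a cycle of `K_n^Γ` is a circuit of `L` if and only
if it is balanced. -/
def balancedLifts (n : ℕ) (Γ : Type u) [Group Γ] : Set (Matroid (GainEdge n Γ)) :=
  {L | IsLift L (cycleMatroid (fullGainGraph n Γ)) ∧
    ∀ C, IsCycle (fullGainGraph n Γ) C → (L.IsCircuit C ↔ IsBalancedCycle C)}

/-- `Γ` has a nontrivial group partition: a partition of the set of non-identity elements, with more
than one part, such that each part together with the identity is a subgroup. (The parts of a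
`Partition` are nonempty and pairwise disjoint.) -/
def HasNontrivialGroupPartition (Γ : Type u) [Group Γ] : Prop :=
  ∃ P : Partition ({1}ᶜ : Set Γ),
    (∀ A ∈ P, ∃ H : Subgroup Γ, (H : Set Γ) = insert 1 A) ∧ P.parts.Nontrivial

end Gain

end LiftMatroid

namespace LiftMatroid

universe u v w

/-! ### Lifts -/

section LiftBasics

variable {β : Type v} {L M : Matroid β}

/-! Write `M` for the cycle matroid. An edge that alone crosses a vertex cut cannot help to span in
a lift `L` of `M`: exchange in `L` would put it in an `L`-closure, hence in an `M`-closure, of edges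
that do not cross the cut. This lets auxiliary edges be added, used in balanced triangles and then
discarded.

Forward direction. For vertices `i ≠ j`, let `H x` be the set of gains of `ij`-edges spanned in `L`
by the `ij`-edges of gains `1` and `x`. A third vertex makes `H x` a subgroup
(`gainEdge_mem_closure_mul`), and exchange makes these subgroups the parts of a partition
(`isPartitionMap_spannedGains`). If some `H x` with `x ≠ 1` is all of `Γ`, then a star and one more
edge span `L`, so `L` is elementary; thus a non-elementary lift gives a nontrivial partition. A
fourth vertex allows `x` to be carried to a disjoint pair of vertices and back along an edge of gain
`g`, so each part is closed under conjugation (`conj_mem_spannedGains`). Elements of different parts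
then commute, because their commutator lies in both parts; it follows that `Γ` is abelian, that all
nontrivial elements have the same order, and that `Γ` is elementary abelian of rank at least two.

Converse. For `Γ = (ℤ/p)^j`, append the coordinates of the gain to the incidence vector of each
edge; killing the extra coordinates recovers `M`. For `n = 3`, refine the partition to a
conjugation-invariant one and build a rank-four matroid on the edges and two further points by
listing its planes; contracting the two points gives `M`. The main fact is that three points common
to two distinct planes are collinear (`IsPartitionMap.collinear_of_subset_of_subset`). Both lifts
have three independent parallel edges, which forces a rank of at least `r(M) + 2`. -/

theorem IsLift.ground_eq (h : IsLift L M) : L.E = M.E := by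
  obtain ⟨k, K, -, hM, hL⟩ := h
  have h1 : (M.mapEmbedding (Function.Embedding.inl (β := Fin k))).E =
      (L.mapEmbedding (Function.Embedding.inl (β := Fin k))).E := by
    rw [hM, hL]; rfl
  exact ((Set.image_injective.2 Sum.inl_injective) h1).symm

theorem IsLift.indep (h : IsLift L M) {I : Set β} (hI : M.Indep I) : L.Indep I := by
  obtain ⟨k, K, -, hM, hL⟩ := h
  have h1 := hI.mapEmbedding (Function.Embedding.inl (β := Fin k))
  rw [hM] at h1
  have h2 : (L.mapEmbedding (Function.Embedding.inl (β := Fin k))).Indep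
      (Function.Embedding.inl '' I) := by
    rw [hL, Matroid.delete_indep_iff]
    refine ⟨h1.of_contract, ?_⟩
    rw [Set.disjoint_left]
    rintro _ ⟨x, -, rfl⟩ ⟨y, hy⟩
    cases hy
  rw [Matroid.mapEmbedding_indep_iff,
    Set.preimage_image_eq _ (Function.Embedding.inl (β := Fin k)).injective] at h2
  exact h2.1

/-- Off `F`, the closure in `L` is `K.closure X` and the closure in `M` is `K.closure (X ∪ F)`. -/
theorem IsLift.closure_subset (h : IsLift L M) (X : Set β) : L.closure X ⊆ M.closure X := by
  obtain ⟨k, K, -, hM, hL⟩ := h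
  intro e he
  have hinj := (Function.Embedding.inl (α := β) (β := Fin k)).injective
  have h1 : ∀ N : Matroid β, (N.mapEmbedding (Function.Embedding.inl (β := Fin k))).closure
      (Function.Embedding.inl '' X) = Function.Embedding.inl '' N.closure X := fun N => by
    rw [Matroid.mapEmbedding, Matroid.map_closure_eq, Set.preimage_image_eq _ hinj]
  have h2 := h1 L
  rw [hL, Matroid.delete_closure_eq] at h2
  have h3 := h1 M
  rw [hM, Matroid.contract_closure_eq] at h3
  have h4 : Function.Embedding.inl (β := Fin k) e ∈ Function.Embedding.inl '' L.closure X :=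
    ⟨e, he, rfl⟩
  rw [← h2] at h4
  have h5 : Function.Embedding.inl (β := Fin k) e ∈ Function.Embedding.inl '' M.closure X := by
    rw [← h3]
    exact ⟨K.closure_subset_closure (Set.sdiff_subset.trans Set.subset_union_left) h4.1, h4.2⟩
  obtain ⟨e', he', h6⟩ := h5
  rwa [← hinj h6]

/-- An element outside the closure in `M` does not help to span others in a lift of `M`. -/
theorem IsLift.mem_closure_of_insert (h : IsLift L M) {X : Set β} {c e : β}
    (he : e ∈ L.closure (insert c X)) (hc : c ∉ M.closure (insert e X)) : e ∈ L.closure X := by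
  by_contra hcon
  exact hc (h.closure_subset _ (Matroid.mem_closure_insert hcon he))

/-- Both constructions of lifts go through this criterion, which leaves only the independent sets of
the contraction to be identified. -/
theorem isLift_comap_inl {k : ℕ} {K : Matroid (β ⊕ Fin k)} (hK : K.E = Set.univ)
    (hF : K.Indep (Set.range Sum.inr))
    (hMK : ∀ I, M.Indep I ↔ K.Indep (Sum.inl '' I ∪ Set.range Sum.inr))
    (hM : M.E = Set.univ) : IsLift (K.comap Sum.inl) M := by
  have hdisj : ∀ I : Set (β ⊕ Fin k), I ⊆ Set.range Sum.inl ↔ Disjoint I (Set.range Sum.inr) := by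
    intro I
    rw [← Set.compl_range_inr, Set.subset_compl_iff_disjoint_right]
  have hrange : Set.range (Function.Embedding.inl : β ↪ β ⊕ Fin k) =
      Set.univ \ Set.range Sum.inr := by
    rw [← Set.compl_eq_univ_sdiff, Set.compl_range_inr]; rfl
  refine ⟨k, K, by simp [hK], Matroid.ext_indep ?_ ?_, Matroid.ext_indep ?_ ?_⟩
  · rw [Matroid.mapEmbedding_ground_eq, Matroid.contract_ground, hM, hK, Set.image_univ, hrange]
  · intro I _
    rw [hF.contract_indep_iff, Matroid.mapEmbedding_indep_iff, hMK, ← hdisj, and_comm]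
    refine and_congr_right fun hI => ?_
    rw [show Sum.inl '' (Function.Embedding.inl ⁻¹' I) = I from Set.image_preimage_eq_of_subset hI]
  · rw [Matroid.mapEmbedding_ground_eq, Matroid.delete_ground, Matroid.comap_ground_eq, hK,
      Set.preimage_univ, Set.image_univ, hrange]
  · intro I _
    rw [Matroid.delete_indep_iff, Matroid.mapEmbedding_indep_iff, ← hdisj]
    refine and_congr_left fun hI => ?_
    rw [Matroid.comap_indep_iff,
      show Sum.inl '' (Function.Embedding.inl ⁻¹' I) = I from Set.image_preimage_eq_of_subset hI]
    exact and_iff_left Sum.inl_injective.injOn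

end LiftBasics

/-! ### Closure in the cycle matroid -/

section Cut

variable {α : Type u} {β : Type v}

/-- If no edge of `X` crosses the vertex set `W`, no edge in the closure of `X` does. -/
theorem mem_iff_mem_of_mem_closure {G : Graph α β} {X : Set β} (W : Set α)
    (hX : ∀ e ∈ X, ∀ x y, G.IsLink e x y → (x ∈ W ↔ y ∈ W)) {c : β} {x y : α}
    (hc : c ∈ (cycleMatroid G).closure X) (hl : G.IsLink c x y) : x ∈ W ↔ y ∈ W := by
  classical
  obtain ⟨J, hJ⟩ := (cycleMatroid G).exists_isBasis' X
  rw [← hJ.closure_eq_closure, hJ.indep.mem_closure_iff'] at hc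
  by_contra hcon
  have hcJ : c ∉ J := fun h => hcon (hX c (hJ.subset h) x y hl)
  refine hcJ (hc.2 ?_)
  have hlin : LinearIndepOn (ZMod 2) (incVec G) J :=
    IsAcyclicSet.linearIndepOn ((cycleMatroid_indep_iff G).1 hJ.indep)
  -- `φ` counts the ends in `W` modulo 2, so it vanishes exactly on the edges that do not cross the
  -- cut.
  let φ : (α →₀ ZMod 2) →ₗ[ZMod 2] ZMod 2 :=
    Finsupp.linearCombination (ZMod 2) (fun v => if v ∈ W then (1 : ZMod 2) else 0)
  have hφ : ∀ e a b, G.IsLink e a b →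
      φ (incVec G e) = (if a ∈ W then 1 else 0) + (if b ∈ W then 1 else 0) := by
    intro e a b h
    simp [φ, incVec_eq h, Finsupp.linearCombination_single]
  have hspan : incVec G c ∉ Submodule.span (ZMod 2) (incVec G '' J) := by
    intro hmem
    have hle : Submodule.span (ZMod 2) (incVec G '' J) ≤ LinearMap.ker φ := by
      rw [Submodule.span_le]
      rintro _ ⟨e, he, rfl⟩
      have heE : e ∈ G.edgeSet := hJ.indep.subset_ground he
      obtain ⟨a, b, hab⟩ := G.exists_isLink_of_mem_edgeSet heE
      have := hX e (hJ.subset he) a b hab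
      simp only [SetLike.mem_coe, LinearMap.mem_ker, hφ e a b hab, this]
      exact CharTwo.add_self_eq_zero _
    have h0 := hle hmem
    rw [LinearMap.mem_ker, hφ c x y hl] at h0
    by_cases hx : x ∈ W <;> by_cases hy : y ∈ W <;> simp_all
  rw [cycleMatroid_indep_iff]
  exact ⟨Set.insert_subset hc.1 hJ.indep.subset_ground,
    fun C hC => not_isCycle_of_linearIndepOn ((linearIndepOn_insert hcJ).2 ⟨hlin, hspan⟩) hC⟩

end Cut

/-! ### Edges of the full gain graph -/

section GainEdges

theorem not_isLink_self {n : ℕ} {Γ : Type u} {e : GainEdge n Γ} {x : Fin n} :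
    ¬ (fullGainGraph n Γ).IsLink e x x := by
  rintro (⟨h1, h2⟩ | ⟨h1, h2⟩)
  exacts [e.1.2.ne (h1.symm.trans h2), e.1.2.ne (h2.symm.trans h1)]

variable {n : ℕ} {Γ : Type u} [Group Γ]

/-- The edge between `i` and `j` that has gain `γ` when traversed from `i` to `j`. -/
def gainEdge {i j : Fin n} (h : i ≠ j) (γ : Γ) : GainEdge n Γ :=
  if hlt : i < j then (⟨(i, j), hlt⟩, γ)
  else (⟨(j, i), lt_of_le_of_ne (not_lt.1 hlt) h.symm⟩, γ⁻¹)

theorem gainEdge_symm {i j : Fin n} (h : i ≠ j) (γ : Γ) :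
    gainEdge h.symm γ⁻¹ = gainEdge h γ := by
  rcases lt_or_gt_of_ne h with h1 | h1 <;> simp [gainEdge, h1, h1.not_gt]

theorem gainEdge_injective {i j : Fin n} (h : i ≠ j) :
    Function.Injective (gainEdge (Γ := Γ) h) := by
  intro γ δ hγ
  rcases lt_or_gt_of_ne h with h1 | h1
  · simpa [gainEdge, h1] using hγ
  · simpa [gainEdge, h1.not_gt] using hγ

theorem isLink_gainEdge_iff {i j : Fin n} (h : i ≠ j) (γ : Γ) (x y : Fin n) :
    (fullGainGraph n Γ).IsLink (gainEdge h γ) x y ↔ (x = i ∧ y = j) ∨ (x = j ∧ y = i) := by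
  rcases lt_or_gt_of_ne h with h1 | h1
  · simp [gainEdge, h1, fullGainGraph]
  · simp only [gainEdge, h1.not_gt, fullGainGraph, dite_false]
    tauto

theorem isLink_gainEdge {i j : Fin n} (h : i ≠ j) (γ : Γ) :
    (fullGainGraph n Γ).IsLink (gainEdge h γ) i j :=
  (isLink_gainEdge_iff h γ i j).2 (Or.inl ⟨rfl, rfl⟩)

theorem gainFrom_gainEdge {i j : Fin n} (h : i ≠ j) (γ : Γ) : gainFrom (gainEdge h γ) i = γ := by
  rcases lt_or_gt_of_ne h with h1 | h1
  · simp [gainEdge, h1, gainFrom]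
  · simp [gainEdge, h1.not_gt, gainFrom, h]

theorem exists_eq_gainEdge (e : GainEdge n Γ) :
    ∃ (i j : Fin n) (h : i ≠ j) (γ : Γ), i < j ∧ e = gainEdge h γ :=
  ⟨e.1.1.1, e.1.1.2, e.1.2.ne, e.2, e.1.2, by simp [gainEdge, e.1.2]⟩

theorem gainEdge_ne {i j k : Fin n} (hij : i ≠ j) (hjk : j ≠ k) (hik : i ≠ k) (α β : Γ) :
    gainEdge hij α ≠ gainEdge hjk β := by
  intro h
  have h1 := isLink_gainEdge hij α
  rw [h, isLink_gainEdge_iff] at h1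
  rcases h1 with ⟨h1, -⟩ | ⟨h1, -⟩
  exacts [hij h1, hik h1]

theorem isCyclicWalk_triangle {i j k : Fin n} (hij : i ≠ j) (hjk : j ≠ k) (hki : k ≠ i)
    (α β γ : Γ) : IsCyclicWalk (fullGainGraph n Γ) ![i, j, k]
      ![gainEdge hij α, gainEdge hjk β, gainEdge hki γ] := by
  have hl : ∀ a, (fullGainGraph n Γ).IsLink
      ((![gainEdge hij α, gainEdge hjk β, gainEdge hki γ] : Fin 3 → GainEdge n Γ) a)
      ((![i, j, k] : Fin 3 → Fin n) a) ((![i, j, k] : Fin 3 → Fin n) (a + 1)) := by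
    intro a
    fin_cases a
    exacts [isLink_gainEdge hij α, isLink_gainEdge hjk β, isLink_gainEdge hki γ]
  refine ⟨?_, ?_, hl⟩
  · intro a b h
    fin_cases a <;> fin_cases b
    exacts [rfl, absurd h hij, absurd h hki.symm, absurd h hij.symm, rfl, absurd h hjk,
      absurd h hki, absurd h hjk.symm, rfl]
  · intro a b h
    have h1 := gainEdge_ne hij hjk hki.symm α β
    have h2 := gainEdge_ne hjk hki hij.symm β γ
    have h3 := gainEdge_ne hki hij hjk.symm γ α
    fin_cases a <;> fin_cases b
    exacts [rfl, absurd h h1, absurd h h3.symm, absurd h h1.symm, rfl, absurd h h2,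
      absurd h h3, absurd h h2.symm, rfl]

theorem range_triangle {β : Type*} (a b c : β) : Set.range ![a, b, c] = {a, b, c} := by
  ext x; simp [eq_comm]; tauto

theorem isCyclicWalk_parallel {i j : Fin n} (hij : i ≠ j) {α β : Γ} (h : α ≠ β) :
    IsCyclicWalk (fullGainGraph n Γ) ![i, j] ![gainEdge hij α, gainEdge hij β] := by
  have hne : gainEdge hij α ≠ gainEdge hij β := fun h1 => h (gainEdge_injective hij h1)
  refine ⟨?_, ?_, ?_⟩
  · intro a b h
    fin_cases a <;> fin_cases b <;> simp_all [eq_comm]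
  · intro a b h
    fin_cases a <;> fin_cases b <;> simp_all [eq_comm]
  · intro a
    fin_cases a
    exacts [isLink_gainEdge hij α, (isLink_gainEdge hij β).symm]

theorem range_pair {β : Type*} (a b : β) : Set.range ![a, b] = {a, b} := by
  ext x; simp [eq_comm]; tauto

/-- Balance asks for some traversal with trivial gain, so all of them must be excluded; for two
parallel edges the gain is a quotient of two distinct elements. -/
theorem not_isBalancedCycle_parallel {i j : Fin n} (hij : i ≠ j) {α β : Γ} (h : α ≠ β) :
    ¬ IsBalancedCycle ({gainEdge hij α, gainEdge hij β} : Set (GainEdge n Γ)) := by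
  rintro ⟨m, v, e, hw, hC, hprod⟩
  have hne : gainEdge hij α ≠ gainEdge hij β := fun h1 => h (gainEdge_injective hij h1)
  have hm : m = 1 := by
    have h1 := Set.ncard_pair hne
    rw [hC, ← Set.image_univ, Set.ncard_image_of_injective _ hw.edge_injective,
      Set.ncard_univ] at h1
    simpa using h1
  subst hm
  have key : ∀ (a b : Γ), e 0 = gainEdge hij a → e 1 = gainEdge hij b → a = b := by
    intro a b ha hb
    have h0 := hw.isLink 0
    rw [ha, isLink_gainEdge_iff] at h0
    simp only [List.ofFn_succ, List.ofFn_zero, List.prod_cons, List.prod_nil, mul_one] at hprod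
    change gainFrom (e 0) (v 0) * gainFrom (e 1) (v 1) = 1 at hprod
    change (v 0 = i ∧ v 1 = j) ∨ (v 0 = j ∧ v 1 = i) at h0
    rw [ha, hb] at hprod
    rcases h0 with ⟨h1, h2⟩ | ⟨h1, h2⟩
    · rw [h1, h2, gainFrom_gainEdge, ← gainEdge_symm hij b, gainFrom_gainEdge] at hprod
      exact mul_inv_eq_one.1 hprod
    · rw [h1, h2, gainFrom_gainEdge, ← gainEdge_symm hij a, gainFrom_gainEdge] at hprod
      exact inv_mul_eq_one.1 hprod
  have h0 : e 0 ∈ Set.range e := ⟨0, rfl⟩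
  have h1 : e 1 ∈ Set.range e := ⟨1, rfl⟩
  have h01 : e 0 ≠ e 1 := fun h => by simpa using hw.edge_injective h
  rw [← hC] at h0 h1
  simp only [Set.mem_insert_iff, Set.mem_singleton_iff] at h0 h1
  rcases h0 with h0 | h0 <;> rcases h1 with h1 | h1
  · exact h01 (h0.trans h1.symm)
  · exact h (key _ _ h0 h1)
  · exact h (key _ _ h0 h1).symm
  · exact h01 (h0.trans h1.symm)

end GainEdges

/-! ### Closures in a lift of the cycle matroid -/

section Forward

variable {n : ℕ} {Γ : Type u} [Group Γ] {L : Matroid (GainEdge n Γ)}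

theorem ground_eq_univ (hL : L ∈ balancedLifts n Γ) : L.E = Set.univ := hL.1.ground_eq

/-- Two edges of a balanced triangle span the third. -/
theorem mem_closure_of_triangle (hL : L ∈ balancedLifts n Γ) {i j k : Fin n} (hij : i ≠ j)
    (hjk : j ≠ k) (hik : i ≠ k) {α β γ : Γ} {X : Set (GainEdge n Γ)}
    (h1 : gainEdge hij α ∈ L.closure X) (h2 : gainEdge hjk β ∈ L.closure X) (hγ : α * β = γ) :
    gainEdge hik γ ∈ L.closure X := by
  subst hγ
  -- The third edge is traversed from `k` back to `i`, hence the inverse gain.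
  have hw := isCyclicWalk_triangle hij hjk hik.symm α β (α * β)⁻¹
  have hc : L.IsCircuit {gainEdge hij α, gainEdge hjk β, gainEdge hik.symm (α * β)⁻¹} := by
    refine (hL.2 _ ⟨2, _, _, hw, (range_triangle _ _ _).symm⟩).2
      ⟨2, _, _, hw, (range_triangle _ _ _).symm, ?_⟩
    simp only [List.ofFn_succ, List.ofFn_zero, List.prod_cons, List.prod_nil, mul_one]
    change gainFrom (gainEdge hij α) i * (gainFrom (gainEdge hjk β) j *
      gainFrom (gainEdge hik.symm (α * β)⁻¹) k) = 1
    simp only [gainFrom_gainEdge]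
    group
  rw [gainEdge_symm hik] at hc
  have h3 := hc.mem_closure_sdiff_singleton_of_mem (e := gainEdge hik (α * β)) (by simp)
  refine L.closure_subset_closure_of_subset_closure ?_ h3
  rintro e ⟨rfl | rfl | rfl, he⟩
  · exact h1
  · exact h2
  · exact absurd rfl he

theorem gainEdge_mem_symm {i j : Fin n} {hij : i ≠ j} {α : Γ} {X : Set (GainEdge n Γ)}
    (h : gainEdge hij α ∈ X) : gainEdge hij.symm α⁻¹ ∈ X := by
  rwa [gainEdge_symm hij]

/-- Distinct parallel edges do not span each other. -/
theorem indep_parallel (hL : L ∈ balancedLifts n Γ) {i j : Fin n} (hij : i ≠ j) {α β : Γ}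
    (h : α ≠ β) : L.Indep {gainEdge hij α, gainEdge hij β} := by
  have hw := isCyclicWalk_parallel hij h
  -- No edge is a loop, so singletons are independent in `M` and hence in `L`. A dependent pair
  -- would therefore be a circuit, and so a balanced cycle.
  have hsing : ∀ γ : Γ, L.Indep {gainEdge hij γ} := by
    intro γ
    refine hL.1.indep ⟨Set.subset_univ _, ?_⟩
    rintro C hC ⟨m, v, e, hwe, rfl⟩
    have h1 : ∀ a, e a = gainEdge hij γ := fun a => hC ⟨a, rfl⟩
    have h2 : (0 : Fin (m + 1)) = 0 + 1 :=
      hwe.edge_injective ((h1 _).trans (h1 _).symm)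
    have h3 := hwe.isLink 0
    rw [← h2] at h3
    exact not_isLink_self h3
  by_contra hcon
  refine not_isBalancedCycle_parallel hij h
    ((hL.2 _ ⟨1, _, _, hw, (range_pair _ _).symm⟩).1 ?_)
  have hne : gainEdge hij α ≠ gainEdge hij β := fun h1 => h (gainEdge_injective hij h1)
  rw [Matroid.isCircuit_iff_dep_forall_sdiff_singleton_indep]
  refine ⟨⟨hcon, by rw [ground_eq_univ hL]; exact Set.subset_univ _⟩, ?_⟩
  rintro e (rfl | rfl)
  · exact (hsing β).subset (by rintro x ⟨rfl | rfl, hx⟩; exacts [absurd rfl hx, rfl])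
  · exact (hsing α).subset (by rintro x ⟨rfl | rfl, hx⟩; exacts [rfl, absurd rfl hx])

end Forward

/-! ### The group partition defined by a non-elementary lift -/

/-- `H` sends each element to the part containing it (together with the identity) in a partition of
the group into subgroups that meet trivially. -/
structure IsPartitionMap {Γ : Type u} [Group Γ] (H : Γ → Subgroup Γ) : Prop where
  mem_self : ∀ x, x ∈ H x
  eq_of_mem : ∀ {x y}, y ∈ H x → y ≠ 1 → H y = H x

section Forward

variable {n : ℕ} {Γ : Type u} [Group Γ] {L : Matroid (GainEdge n Γ)}

/-- An edge crossing a cut that nothing else crosses can be dropped from a spanning set. -/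
theorem mem_closure_of_cut (hL : L ∈ balancedLifts n Γ) (W : Set (Fin n))
    {X : Set (GainEdge n Γ)} {e : GainEdge n Γ} {a b : Fin n} {hab : a ≠ b} {γ : Γ}
    (hX : ∀ f ∈ insert e X, ∃ (c d : Fin n) (h : c ≠ d) (δ : Γ), f = gainEdge h δ ∧ (c ∈ W ↔ d ∈ W))
    (hW : ¬ (a ∈ W ↔ b ∈ W)) (he : e ∈ L.closure (insert (gainEdge hab γ) X)) :
    e ∈ L.closure X := by
  refine hL.1.mem_closure_of_insert he fun hc => hW ?_
  refine mem_iff_mem_of_mem_closure W ?_ hc (isLink_gainEdge hab γ)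
  intro f hf x y hxy
  obtain ⟨c, d, h, δ, rfl, hcd⟩ := hX f hf
  rw [isLink_gainEdge_iff] at hxy
  rcases hxy with ⟨rfl, rfl⟩ | ⟨rfl, rfl⟩
  exacts [hcd, hcd.symm]

theorem mem_closure_of_mem (hL : L ∈ balancedLifts n Γ) {X : Set (GainEdge n Γ)}
    {e : GainEdge n Γ} (he : e ∈ X) : e ∈ L.closure X :=
  L.mem_closure_of_mem' he (by rw [ground_eq_univ hL]; trivial)

/-- The edge `ik` of gain `1` lets balanced triangles move gains among the three pairs, which
produces products and inverses. It alone crosses the cut around `k`, so it can be dropped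
afterwards. -/
theorem gainEdge_mem_closure_mul (hL : L ∈ balancedLifts n Γ) {i j k : Fin n} (hij : i ≠ j)
    (hik : i ≠ k) (hjk : j ≠ k) {x y z : Γ}
    (hy : gainEdge hij y ∈ L.closure {gainEdge hij 1, gainEdge hij x})
    (hz : gainEdge hij z ∈ L.closure {gainEdge hij 1, gainEdge hij x}) :
    gainEdge hij (y * z) ∈ L.closure {gainEdge hij 1, gainEdge hij x} ∧
      gainEdge hij y⁻¹ ∈ L.closure {gainEdge hij 1, gainEdge hij x} := by
  have drop : ∀ w : Γ, gainEdge hij w ∈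
      L.closure (insert (gainEdge hik 1) {gainEdge hij 1, gainEdge hij x}) →
      gainEdge hij w ∈ L.closure {gainEdge hij 1, gainEdge hij x} := by
    intro w hw
    refine mem_closure_of_cut hL {k} ?_ ?_ hw
    · rintro f (rfl | rfl | rfl)
      all_goals exact ⟨i, j, hij, _, rfl, by simp [hik, hjk]⟩
    · simp [hik]
  have hsub := L.closure_subset_closure
    (Set.subset_insert (gainEdge hik (1 : Γ)) {gainEdge hij 1, gainEdge hij x})
  set A := L.closure (insert (gainEdge hik (1 : Γ)) {gainEdge hij 1, gainEdge hij x})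
  have h1 : gainEdge hij 1 ∈ A := mem_closure_of_mem hL (by simp)
  have h2 : gainEdge hik 1 ∈ A := mem_closure_of_mem hL (by simp)
  have h3 : gainEdge hjk 1 ∈ A :=
    mem_closure_of_triangle hL hij.symm hik hjk (gainEdge_mem_symm h1) h2 (by simp)
  have key : ∀ w v : Γ, gainEdge hij w ∈ A → gainEdge hjk v ∈ A → gainEdge hij (w * v) ∈ A := by
    intro w v hw hv
    refine mem_closure_of_triangle hL hik hjk.symm hij ?_ (gainEdge_mem_symm h3)
      (show w * v * 1⁻¹ = w * v by simp)
    exact mem_closure_of_triangle hL hij hjk hik hw hv rfl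
  refine ⟨drop _ (key _ _ (hsub hy) ?_), drop _ ?_⟩
  · refine mem_closure_of_triangle hL hij.symm hik hjk (gainEdge_mem_symm h1) ?_
      (show 1⁻¹ * z = z by simp)
    exact mem_closure_of_triangle hL hij hjk hik (hsub hz) h3 (by simp)
  · have h4 := key _ y⁻¹ h1
      (mem_closure_of_triangle hL hij.symm hik hjk (gainEdge_mem_symm (hsub hy)) h2 (by simp))
    simpa using h4

/-- The gains of the edges spanned by two parallel edges of gains `1` and `x`. -/
def spannedGains (hL : L ∈ balancedLifts n Γ) {i j k : Fin n} (hij : i ≠ j) (hik : i ≠ k)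
    (hjk : j ≠ k) (x : Γ) : Subgroup Γ where
  carrier := {y | gainEdge hij y ∈ L.closure {gainEdge hij 1, gainEdge hij x}}
  mul_mem' hy hz := (gainEdge_mem_closure_mul hL hij hik hjk hy hz).1
  one_mem' := mem_closure_of_mem hL (by simp)
  inv_mem' hy := (gainEdge_mem_closure_mul hL hij hik hjk hy hy).2

/-- An edge of gain `y ≠ 1` is not spanned by the one of gain `1`, so by exchange `y` can replace
`x` in the spanning pair. -/
theorem isPartitionMap_spannedGains (hL : L ∈ balancedLifts n Γ) {i j k : Fin n} (hij : i ≠ j)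
    (hik : i ≠ k) (hjk : j ≠ k) : IsPartitionMap (spannedGains hL hij hik hjk) := by
  refine ⟨fun x => mem_closure_of_mem hL (by simp), fun {x y} hy hy1 => ?_⟩
  have h1 : gainEdge hij y ∈ L.closure (insert (gainEdge hij x) {gainEdge hij 1}) \
      L.closure {gainEdge hij 1} := by
    refine ⟨by rw [Set.pair_comm]; exact hy, fun hcon => ?_⟩
    have hne : gainEdge hij y ∉ ({gainEdge hij 1} : Set (GainEdge n Γ)) :=
      fun h => hy1 (gainEdge_injective hij h)
    have h2 := indep_parallel hL hij hy1
    rw [((h2.subset (Set.subset_insert _ _)).insert_indep_iff_of_notMem hne)] at h2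
    exact h2.2 hcon
  have h2 := Matroid.closure_insert_congr h1
  ext z
  change gainEdge hij z ∈ L.closure {gainEdge hij 1, gainEdge hij y} ↔
    gainEdge hij z ∈ L.closure {gainEdge hij 1, gainEdge hij x}
  rw [Set.pair_comm, h2, Set.pair_comm]

theorem conj_mem_spannedGains (hL : L ∈ balancedLifts n Γ) {i j k l : Fin n} (hij : i ≠ j)
    (hik : i ≠ k) (hjk : j ≠ k) (hil : i ≠ l) (hjl : j ≠ l) (hkl : k ≠ l) (x g : Γ) :
    g * x * g⁻¹ ∈ spannedGains hL hij hik hjk x := by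
  change gainEdge hij (g * x * g⁻¹) ∈ L.closure {gainEdge hij 1, gainEdge hij x}
  -- The gain `x` is carried from `ij` to the disjoint pair `kl` by edges of gain `1`; the
  -- connecting edge `ik` alone crosses the cut `{i, j}` and is dropped.
  have hx : gainEdge hkl x ∈
      L.closure (insert (gainEdge hkl (1 : Γ)) {gainEdge hij (1 : Γ), gainEdge hij x}) := by
    refine mem_closure_of_cut hL {i, j} (a := i) (b := k) (hab := hik) (γ := 1) ?_ ?_ ?_
    · rintro f (rfl | rfl | rfl | rfl)
      · exact ⟨k, l, hkl, _, rfl, by simp [hik.symm, hjk.symm, hil.symm, hjl.symm]⟩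
      · exact ⟨k, l, hkl, _, rfl, by simp [hik.symm, hjk.symm, hil.symm, hjl.symm]⟩
      all_goals exact ⟨i, j, hij, _, rfl, by simp⟩
    · simp [hik.symm, hjk.symm]
    · set Y : Set (GainEdge n Γ) := insert (gainEdge hik (1 : Γ))
        (insert (gainEdge hkl (1 : Γ)) {gainEdge hij (1 : Γ), gainEdge hij x})
      have h1 : gainEdge hij 1 ∈ L.closure Y := mem_closure_of_mem hL (by simp [Y])
      have h2 : gainEdge hik 1 ∈ L.closure Y := mem_closure_of_mem hL (by simp [Y])
      have h3 : gainEdge hkl 1 ∈ L.closure Y := mem_closure_of_mem hL (by simp [Y])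
      have h4 : gainEdge hij x ∈ L.closure Y := mem_closure_of_mem hL (by simp [Y])
      have h5 : gainEdge hil 1 ∈ L.closure Y := mem_closure_of_triangle hL hik hkl hil h2 h3 (by simp)
      have h6 : gainEdge hjl 1 ∈ L.closure Y :=
        mem_closure_of_triangle hL hij.symm hil hjl (gainEdge_mem_symm h1) h5 (by simp)
      have h7 : gainEdge hil x ∈ L.closure Y := mem_closure_of_triangle hL hij hjl hil h4 h6 (by simp)
      exact mem_closure_of_triangle hL hik.symm hil hkl (gainEdge_mem_symm h2) h7 (by simp)
  -- On the way back the connecting edge `ik` has gain `g`. Now `il` acquires the gains `g` and `g *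
  -- x`, while `jl` acquires `g`, so `ij` acquires `g * x * g⁻¹`. The cuts around `l` and `k` remove
  -- the auxiliary edges.
  refine mem_closure_of_cut hL {k} (a := i) (b := k) (hab := hik) (γ := g) ?_ (by simp [hik]) ?_
  · rintro f (rfl | rfl | rfl)
    all_goals exact ⟨i, j, hij, _, rfl, by simp [hik, hjk]⟩
  refine mem_closure_of_cut hL {l} (a := k) (b := l) (hab := hkl) (γ := 1) ?_ (by simp [hkl]) ?_
  · rintro f (rfl | rfl | rfl | rfl)
    · exact ⟨i, j, hij, _, rfl, by simp [hil, hjl]⟩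
    · exact ⟨i, k, hik, _, rfl, by simp [hil, hkl]⟩
    all_goals exact ⟨i, j, hij, _, rfl, by simp [hil, hjl]⟩
  set Y : Set (GainEdge n Γ) := insert (gainEdge hkl (1 : Γ)) (insert (gainEdge hik g) {gainEdge hij (1 : Γ), gainEdge hij x})
  have h1 : gainEdge hij 1 ∈ L.closure Y := mem_closure_of_mem hL (by simp [Y])
  have h2 : gainEdge hik g ∈ L.closure Y := mem_closure_of_mem hL (by simp [Y])
  have h3 : gainEdge hkl 1 ∈ L.closure Y := mem_closure_of_mem hL (by simp [Y])
  have h4 : gainEdge hkl x ∈ L.closure Y :=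
    L.closure_subset_closure (Set.insert_subset_insert (Set.subset_insert _ _)) hx
  have h5 : gainEdge hil g ∈ L.closure Y := mem_closure_of_triangle hL hik hkl hil h2 h3 (by simp)
  have h6 : gainEdge hjl g ∈ L.closure Y :=
    mem_closure_of_triangle hL hij.symm hil hjl (gainEdge_mem_symm h1) h5 (by simp)
  have h7 : gainEdge hil (g * x) ∈ L.closure Y := mem_closure_of_triangle hL hik hkl hil h2 h4 rfl
  exact mem_closure_of_triangle hL hil hjl.symm hij h7 (gainEdge_mem_symm h6) rfl

/-- The edges of gain `1` at the vertex `i`. -/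
def star (Γ : Type u) [Group Γ] (i : Fin n) : Set (GainEdge n Γ) :=
  {e | ∃ (k : Fin n) (h : i ≠ k), e = gainEdge h 1}

theorem indep_star (i : Fin n) : (cycleMatroid (fullGainGraph n Γ)).Indep (star Γ i) := by
  rw [Matroid.indep_iff_forall_notMem_closure_sdiff (Set.subset_univ _)]
  rintro _ ⟨k, hk, rfl⟩ hcl
  have := mem_iff_mem_of_mem_closure {k} ?_ hcl (isLink_gainEdge hk 1)
  · simp [hk] at this
  · rintro _ ⟨⟨l, hl, rfl⟩, hne⟩ x y hxy
    have hlk : l ≠ k := by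
      rintro rfl
      exact hne rfl
    rw [isLink_gainEdge_iff] at hxy
    rcases hxy with ⟨rfl, rfl⟩ | ⟨rfl, rfl⟩ <;> simp [hk, hlk]

theorem mem_closure_star {i j : Fin n} (hij : i ≠ j) (γ : Γ) :
    gainEdge hij γ ∈ (cycleMatroid (fullGainGraph n Γ)).closure (star Γ i) := by
  rw [(indep_star i).mem_closure_iff']
  refine ⟨Set.mem_univ _, fun h => ?_⟩
  by_cases hγ : γ = 1
  · subst hγ
    exact ⟨j, hij, rfl⟩
  · refine absurd ⟨1, _, _, isCyclicWalk_parallel hij hγ, rfl⟩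
      (((cycleMatroid_indep_iff _).1 h).2 _ ?_)
    rw [range_pair]
    rintro f (rfl | rfl)
    exacts [Or.inl rfl, Or.inr ⟨j, hij, rfl⟩]

/-- Both rank comparisons between `L` and `M` count against this base. -/
theorem isBase_star (i : Fin n) : (cycleMatroid (fullGainGraph n Γ)).IsBase (star Γ i) := by
  refine (indep_star i).isBase_of_ground_subset_closure fun e _ => ?_
  obtain ⟨a, b, hab, γ, -, rfl⟩ := exists_eq_gainEdge e
  by_cases ha : i = a
  · subst ha; exact mem_closure_star hab γ
  by_cases hb : i = b
  · subst hb
    rw [← gainEdge_symm]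
    exact mem_closure_star hab.symm γ⁻¹
  rw [(indep_star i).mem_closure_iff']
  refine ⟨Set.mem_univ _, fun h => absurd
    ⟨2, _, _, isCyclicWalk_triangle ha hab (Ne.symm hb) (1 : Γ) γ 1⁻¹, rfl⟩
    (((cycleMatroid_indep_iff _).1 h).2 _ ?_)⟩
  rw [range_triangle, gainEdge_symm hb]
  rintro f (rfl | rfl | rfl)
  exacts [Or.inr ⟨a, ha, rfl⟩, Or.inl rfl, Or.inr ⟨b, hb, rfl⟩]

/-- The edges of a star add nothing to the span of a set of parallel edges. -/
theorem mem_closure_of_mem_closure_union_star (hL : L ∈ balancedLifts n Γ) {i j : Fin n}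
    (hij : i ≠ j) {X : Set (GainEdge n Γ)} (hX : X ⊆ Set.range (gainEdge hij))
    (h1 : gainEdge hij 1 ∈ X) {x : Γ} (hx : gainEdge hij x ∈ L.closure (X ∪ star Γ i)) :
    gainEdge hij x ∈ L.closure X := by
  -- The star edges are removed one at a time; the edge to `k` is the only one that crosses the cut
  -- around `k`.
  have key : ∀ T : Finset (Fin n), i ∉ T → j ∉ T →
      gainEdge hij x ∈ L.closure (X ∪ {e | ∃ k ∈ T, ∃ h : i ≠ k, e = gainEdge h 1}) →
      gainEdge hij x ∈ L.closure X := by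
    intro T
    induction T using Finset.induction_on with
    | empty => exact fun _ _ hcl => by simpa using hcl
    | insert k T hkT ih =>
      intro hi hj hcl
      rw [Finset.mem_insert, not_or] at hi hj
      refine ih hi.2 hj.2 (mem_closure_of_cut hL {k} (a := i) (b := k) (hab := hi.1) (γ := 1) ?_
        (by simp [hi.1]) (L.closure_subset_closure ?_ hcl))
      · rintro f (rfl | hf | ⟨l, hl, h, rfl⟩)
        · exact ⟨i, j, hij, _, rfl, by simp [hi.1, hj.1]⟩
        · obtain ⟨γ, rfl⟩ := hX hf
          exact ⟨i, j, hij, _, rfl, by simp [hi.1, hj.1]⟩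
        · exact ⟨i, l, h, _, rfl, by simp [hi.1, ne_of_mem_of_not_mem hl hkT]⟩
      · rintro f (hf | ⟨l, hl, h, rfl⟩)
        · exact Or.inr (Or.inl hf)
        · rcases Finset.mem_insert.1 hl with rfl | hl
          · exact Or.inl rfl
          · exact Or.inr (Or.inr ⟨l, hl, h, rfl⟩)
  -- The star edge to `j` is not removed but absorbed: it is the edge of gain `1` in `X`.
  refine key ((Finset.univ.erase i).erase j) (by simp) (by simp) (L.closure_subset_closure ?_ hx)
  rintro _ (hf | ⟨k, hk, rfl⟩)
  · exact Or.inl hf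
  · by_cases hkj : k = j
    · subst hkj; exact Or.inl h1
    · exact Or.inr ⟨k, by simp [hkj, hk.symm], hk, rfl⟩

theorem notMem_closure_star (hL : L ∈ balancedLifts n Γ) {i j : Fin n} (hij : i ≠ j) {x : Γ}
    (hx : x ≠ 1) : gainEdge hij x ∉ L.closure (star Γ i) := by
  intro hcl
  have h1 := mem_closure_of_mem_closure_union_star hL hij (X := {gainEdge hij 1})
    (by simp) rfl (L.closure_subset_closure Set.subset_union_right hcl)
  have h2 := indep_parallel hL hij hx
  have hne : gainEdge hij x ∉ ({gainEdge hij 1} : Set (GainEdge n Γ)) :=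
    fun h => hx (gainEdge_injective hij h)
  rw [((h2.subset (Set.subset_insert _ _)).insert_indep_iff_of_notMem hne)] at h2
  exact h2.2 h1

/-- A star does not enlarge the span within the parallel class, so two of the three edges stay
independent over it. This gives an independent set of size `r(M) + 2`. -/
theorem not_isElementaryLift_of_indep [Finite Γ] (hL : L ∈ balancedLifts n Γ) {i j : Fin n}
    (hij : i ≠ j) {x y : Γ} (hx : x ≠ 1) (hy : y ≠ 1) (hxy : x ≠ y)
    (hI : L.Indep {gainEdge hij y, gainEdge hij x, gainEdge hij 1}) :
    ¬ IsElementaryLift L (cycleMatroid (fullGainGraph n Γ)) := by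
  rintro ⟨-, hr⟩
  have hinj := gainEdge_injective (Γ := Γ) hij
  have hxS : gainEdge hij x ∉ L.closure (star Γ i) := notMem_closure_star hL hij hx
  have hyS : gainEdge hij y ∉ L.closure (insert (gainEdge hij x) (star Γ i)) := by
    intro hcl
    have h1 := mem_closure_of_mem_closure_union_star hL hij
      (X := {gainEdge hij x, gainEdge hij 1})
      (by rintro f (rfl | rfl) <;> exact ⟨_, rfl⟩) (by simp)
      (L.closure_subset_closure (by
        rintro f (rfl | hf)
        exacts [Or.inl (Or.inl rfl), Or.inr hf]) hcl)
    have hne : gainEdge hij y ∉ ({gainEdge hij x, gainEdge hij 1} : Set (GainEdge n Γ)) := by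
      rintro (h | h)
      exacts [hxy (hinj h).symm, hy (hinj h)]
    rw [((hI.subset (Set.subset_insert _ _)).insert_indep_iff_of_notMem hne)] at hI
    exact hI.2 h1
  have hgr : ∀ e, e ∈ L.E := fun e => by rw [ground_eq_univ hL]; trivial
  have h1 : L.Indep (insert (gainEdge hij x) (star Γ i)) := by
    rw [(hL.1.indep (indep_star i)).insert_indep_iff]
    exact Or.inl ⟨hgr _, hxS⟩
  have h2 : L.Indep (insert (gainEdge hij y) (insert (gainEdge hij x) (star Γ i))) := by
    rw [h1.insert_indep_iff]
    exact Or.inl ⟨hgr _, hyS⟩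
  have h3 := h2.encard_le_eRank
  rw [hr, ← (isBase_star i).encard_eq_eRank,
    Set.encard_insert_of_notMem fun h => hyS (mem_closure_of_mem hL h),
    Set.encard_insert_of_notMem fun h => hxS (mem_closure_of_mem hL h),
    ← (star Γ i).toFinite.cast_ncard_eq] at h3
  norm_cast at h3
  omega

/-- The star at `i` and the one edge of gain `x` span all `ij`-edges, then by balanced triangles all
edges at `i`, and then everything. -/
theorem isElementaryLift_of_spannedGains_eq_top (hL : L ∈ balancedLifts n Γ) {i j k : Fin n}
    (hij : i ≠ j) (hik : i ≠ k) (hjk : j ≠ k) {x : Γ} (hx : x ≠ 1)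
    (hH : spannedGains hL hij hik hjk x = ⊤) :
    IsElementaryLift L (cycleMatroid (fullGainGraph n Γ)) := by
  have hnot := notMem_closure_star hL hij hx
  have hSL : L.Indep (star Γ i) := hL.1.indep (indep_star i)
  have hsub : ∀ e ∈ insert (gainEdge hij x) (star Γ i),
      e ∈ L.closure (insert (gainEdge hij x) (star Γ i)) := fun e he => mem_closure_of_mem hL he
  have hpar : ∀ y, gainEdge hij y ∈ L.closure (insert (gainEdge hij x) (star Γ i)) := by
    intro y
    have h1 : y ∈ spannedGains hL hij hik hjk x := hH ▸ Subgroup.mem_top y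
    refine L.closure_subset_closure ?_ h1
    rintro f (rfl | rfl)
    exacts [Or.inr ⟨j, hij, rfl⟩, Or.inl rfl]
  have hstar : ∀ (l : Fin n) (hl : i ≠ l) (y : Γ),
      gainEdge hl y ∈ L.closure (insert (gainEdge hij x) (star Γ i)) := by
    intro l hl y
    by_cases hlj : l = j
    · subst hlj; exact hpar y
    · have h1 := mem_closure_of_triangle hL hij.symm hl (Ne.symm hlj)
        (gainEdge_mem_symm (hpar 1)) (hsub _ (Or.inr ⟨l, hl, rfl⟩)) rfl
      exact mem_closure_of_triangle hL hij (Ne.symm hlj) hl (hpar y) h1 (by simp)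
  have hspan : ∀ e, e ∈ L.closure (insert (gainEdge hij x) (star Γ i)) := by
    intro e
    obtain ⟨a, b, hab, γ, -, rfl⟩ := exists_eq_gainEdge e
    by_cases ha : i = a
    · subst ha; exact hstar _ _ _
    by_cases hb : i = b
    · subst hb
      have := gainEdge_mem_symm (hstar a ha γ⁻¹)
      rwa [inv_inv] at this
    · exact mem_closure_of_triangle hL (Ne.symm ha) hb hab (gainEdge_mem_symm (hstar a ha 1))
        (hstar b hb γ) (by simp)
  have hbL : L.IsBase (insert (gainEdge hij x) (star Γ i)) := by
    refine Matroid.Indep.isBase_of_ground_subset_closure ?_ fun e _ => hspan e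
    rw [hSL.insert_indep_iff]
    exact Or.inl ⟨by rw [ground_eq_univ hL]; trivial, hnot⟩
  refine ⟨hL.1, ?_⟩
  rw [← hbL.encard_eq_eRank, ← (isBase_star i).encard_eq_eRank, Set.encard_insert_of_notMem]
  exact fun h => hnot (mem_closure_of_mem hL h)

end Forward

/-! ### Group partitions -/

section Partitions

variable {Γ : Type u} [Group Γ] {H : Γ → Subgroup Γ}

theorem IsPartitionMap.mem_symm (hH : IsPartitionMap H) {x y : Γ} (hy : y ∈ H x) (hy1 : y ≠ 1) :
    x ∈ H y := by
  rw [hH.eq_of_mem hy hy1]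
  exact hH.mem_self x

theorem IsPartitionMap.eq_of_mem_of_mem (hH : IsPartitionMap H) {x y z : Γ} (hz : z ≠ 1)
    (hx : z ∈ H x) (hy : z ∈ H y) : H x = H y :=
  (hH.eq_of_mem hx hz).symm.trans (hH.eq_of_mem hy hz)

theorem IsPartitionMap.hasNontrivialGroupPartition [Nontrivial Γ] (hH : IsPartitionMap H)
    (hprop : ∀ x, x ≠ 1 → H x ≠ ⊤) : HasNontrivialGroupPartition Γ := by
  let parts : Set (Set Γ) := {A | ∃ x, x ≠ 1 ∧ A = (H x : Set Γ) \ {1}}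
  have hmem : ∀ x, x ≠ 1 → x ∈ (H x : Set Γ) \ {1} := fun x hx => ⟨hH.mem_self x, hx⟩
  have hdisj : parts.PairwiseDisjoint id := by
    rintro _ ⟨x, hx, rfl⟩ _ ⟨y, hy, rfl⟩ hne
    rw [Function.onFun, Set.disjoint_left]
    rintro z ⟨hzx, hz⟩ ⟨hzy, -⟩
    exact hne (by rw [hH.eq_of_mem_of_mem hz hzx hzy])
  refine ⟨⟨parts, sSupIndep_iff_pairwiseDisjoint.2 hdisj, ?_, ?_⟩, ?_, ?_⟩
  · rintro ⟨x, hx, h⟩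
    have := hmem x hx
    rw [← h] at this
    exact this
  · ext z
    constructor
    · rintro ⟨_, ⟨x, hx, rfl⟩, hz⟩
      exact hz.2
    · intro hz
      exact ⟨_, ⟨z, hz, rfl⟩, hmem z hz⟩
  · rintro _ ⟨x, hx, rfl⟩
    refine ⟨H x, ?_⟩
    rw [Set.insert_sdiff_singleton, Set.insert_eq_of_mem (H x).one_mem]
  · obtain ⟨x, hx⟩ := exists_ne (1 : Γ)
    obtain ⟨y, -, hy⟩ := SetLike.exists_of_lt (lt_top_iff_ne_top.2 (hprop x hx))
    have hy1 : y ≠ 1 := fun h => hy (h ▸ (H x).one_mem)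
    refine ⟨_, ⟨x, hx, rfl⟩, _, ⟨y, hy1, rfl⟩, fun h => hy ?_⟩
    have := hmem y hy1
    rw [← h] at this
    exact this.1

theorem HasNontrivialGroupPartition.exists_isPartitionMap (h : HasNontrivialGroupPartition Γ) :
    ∃ H : Γ → Subgroup Γ, IsPartitionMap H ∧ ∃ a b, a ≠ 1 ∧ b ≠ 1 ∧ b ∉ H a := by
  classical
  obtain ⟨P, hP, hnt⟩ := h
  have hpart : ∀ x : Γ, x ≠ 1 → ∃ (A : Set Γ) (K : Subgroup Γ),
      A ∈ P ∧ x ∈ A ∧ (K : Set Γ) = insert 1 A := by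
    intro x hx
    have h1 : x ∈ sSup P.parts := by
      rw [P.sSup_eq']; exact hx
    obtain ⟨A, hA, hxA⟩ := h1
    obtain ⟨K, hK⟩ := hP A hA
    exact ⟨A, K, hA, hxA, hK⟩
  choose! A K hA hxA hK using hpart
  have h1A : ∀ B ∈ P, (1 : Γ) ∉ B := by
    intro B hB h1
    have h2 : (1 : Γ) ∈ sSup P.parts := ⟨B, hB, h1⟩
    rw [P.sSup_eq'] at h2
    exact h2 rfl
  have huniq : ∀ B ∈ P, ∀ C ∈ P, ∀ z, z ∈ B → z ∈ C → B = C := by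
    intro B hB C hC z hzB hzC
    by_contra hne
    exact Set.disjoint_left.1 (P.disjoint hB hC hne) hzB hzC
  have hmem : ∀ x, x ≠ 1 → ∀ y, y ≠ 1 → (y ∈ K x ↔ y ∈ A x) := by
    intro x hx y hy
    rw [← SetLike.mem_coe, hK x hx, Set.mem_insert_iff, or_iff_right hy]
  -- The identity lies in no part; the value `⊥` there makes the second condition vacuous.
  refine ⟨fun x => if x = 1 then ⊥ else K x, ⟨?_, ?_⟩, ?_⟩
  · intro x
    by_cases hx : x = 1
    · simp [hx]
    · simp only [hx, if_false]
      exact (hmem x hx x hx).2 (hxA x hx)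
  · intro x y hy hy1
    by_cases hx : x = 1
    · simp [hx, hy1] at hy
    · simp only [hx, hy1, if_false] at hy ⊢
      have h2 := huniq _ (hA x hx) _ (hA y hy1) y ((hmem x hx y hy1).1 hy) (hxA y hy1)
      apply SetLike.coe_injective
      rw [hK x hx, hK y hy1, h2]
  · obtain ⟨B, hB, C, hC, hne⟩ := hnt
    have hnonempty : ∀ B ∈ P, ∃ b, b ∈ B := by
      intro B hB
      by_contra hcon
      push Not at hcon
      exact P.bot_notMem' (by
        rw [show (⊥ : Set Γ) = B from (Set.eq_empty_of_forall_notMem hcon).symm]; exact hB)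
    obtain ⟨b, hb⟩ := hnonempty B hB
    obtain ⟨c, hc⟩ := hnonempty C hC
    have hb1 : b ≠ 1 := fun h => h1A B hB (h ▸ hb)
    have hc1 : c ≠ 1 := fun h => h1A C hC (h ▸ hc)
    refine ⟨b, c, hb1, hc1, ?_⟩
    simp only [hb1, if_false]
    rw [hmem b hb1 c hc1, huniq _ (hA b hb1) _ hB b (hxA b hb1) hb]
    intro hcB
    exact hne (huniq _ hB _ hC c hcB hc)

/-- The common refinement of the conjugates of a group partition. -/
def conjRefinement (H : Γ → Subgroup Γ) (x : Γ) : Subgroup Γ :=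
  ⨅ g : Γ, (H (g * x * g⁻¹)).comap (MulAut.conj g).toMonoidHom

theorem mem_conjRefinement {x y : Γ} :
    y ∈ conjRefinement H x ↔ ∀ g, g * y * g⁻¹ ∈ H (g * x * g⁻¹) := by
  simp [conjRefinement, Subgroup.mem_iInf]

theorem IsPartitionMap.conjRefinement (hH : IsPartitionMap H) :
    IsPartitionMap (conjRefinement H) := by
  refine ⟨fun x => mem_conjRefinement.2 fun g => hH.mem_self _, fun {x y} hy hy1 => ?_⟩
  ext z
  rw [mem_conjRefinement] at hy
  simp only [mem_conjRefinement]
  refine forall_congr' fun g => ?_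
  rw [hH.eq_of_mem (hy g) (by simpa using hy1)]

theorem conj_mem_conjRefinement {x y : Γ} (g : Γ) (hy : y ∈ LiftMatroid.conjRefinement H x) :
    g * y * g⁻¹ ∈ LiftMatroid.conjRefinement H (g * x * g⁻¹) := by
  rw [mem_conjRefinement] at hy ⊢
  intro k
  -- Conjugation by `g` only reindexes the family being intersected.
  have := hy (k * g)
  simpa [mul_assoc] using this

/-- Every nontrivial group partition can be refined to one that is invariant under conjugation. -/
theorem HasNontrivialGroupPartition.exists_conj_invariant (h : HasNontrivialGroupPartition Γ) :
    ∃ H : Γ → Subgroup Γ, IsPartitionMap H ∧ (∃ a b, a ≠ 1 ∧ b ≠ 1 ∧ b ∉ H a) ∧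
      ∀ g x y, y ∈ H x → g * y * g⁻¹ ∈ H (g * x * g⁻¹) := by
  obtain ⟨H, hH, a, b, ha, hb, hab⟩ := h.exists_isPartitionMap
  refine ⟨LiftMatroid.conjRefinement H, hH.conjRefinement, ⟨a, b, ha, hb, fun hcon => hab ?_⟩,
    fun g x y => conj_mem_conjRefinement g⟩
  simpa using mem_conjRefinement.1 hcon 1

theorem IsPartitionMap.exists_notMem (hprop : ∀ x, x ≠ 1 → H x ≠ ⊤) {x : Γ} (hx : x ≠ 1) :
    ∃ y, y ∉ H x ∧ y ≠ 1 := by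
  obtain ⟨y, -, hy⟩ := SetLike.exists_of_lt (lt_top_iff_ne_top.2 (hprop x hx))
  exact ⟨y, hy, fun h => hy (h ▸ (H x).one_mem)⟩

/-- The commutator is `x` times a conjugate of `x⁻¹`, and also a conjugate of `y` times `y⁻¹`. It
lies in both parts, which meet trivially. -/
theorem IsPartitionMap.commute_of_notMem (hH : IsPartitionMap H)
    (hconj : ∀ g x, g * x * g⁻¹ ∈ H x) {x y : Γ} (hy : y ∉ H x) : x * y = y * x := by
  by_contra hne
  have hz : x * y * x⁻¹ * y⁻¹ ≠ 1 := fun h => hne (by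
    rw [mul_inv_eq_one, mul_inv_eq_iff_eq_mul] at h; exact h)
  have h1 : x * y * x⁻¹ * y⁻¹ ∈ H x := by
    have := (H x).mul_mem (hH.mem_self x) ((H x).inv_mem (hconj y x))
    convert this using 1
    group
  have h2 : x * y * x⁻¹ * y⁻¹ ∈ H y :=
    (H y).mul_mem (hconj x y) ((H y).inv_mem (hH.mem_self y))
  rw [hH.eq_of_mem_of_mem hz h1 h2] at hy
  exact hy (hH.mem_self y)

theorem IsPartitionMap.commute (hH : IsPartitionMap H) (hprop : ∀ x, x ≠ 1 → H x ≠ ⊤)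
    (hconj : ∀ g x, g * x * g⁻¹ ∈ H x) (x y : Γ) : x * y = y * x := by
  by_cases hx : x = 1
  · simp [hx]
  by_cases hy : y ∈ H x
  · obtain ⟨z, hz, -⟩ := exists_notMem hprop hx
    have h1 := hH.commute_of_notMem hconj hz
    have h2 := hH.commute_of_notMem hconj
      (fun h => hz (((H x).mul_mem_cancel_left hy).1 h) : y * z ∉ H x)
    rw [← mul_assoc, mul_assoc y, ← h1, ← mul_assoc] at h2
    exact mul_right_cancel h2
  · exact hH.commute_of_notMem hconj hy

/-- With `m` the order of `x`, `(x * y) ^ m = y ^ m` lies in the parts of `x * y` and of `y`. If it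
were nontrivial, these would coincide and `x` would lie in the part of `y`. -/
theorem IsPartitionMap.pow_orderOf_eq_one_of_notMem (hH : IsPartitionMap H)
    (hcomm : ∀ x y : Γ, x * y = y * x) {x y : Γ} (hx : x ≠ 1) (hy : y ∉ H x) :
    y ^ orderOf x = 1 := by
  by_contra hne
  have h1 : y ^ orderOf x ∈ H (x * y) := by
    have := (H (x * y)).pow_mem (hH.mem_self (x * y)) (orderOf x)
    rwa [(show Commute x y from hcomm x y).mul_pow, pow_orderOf_eq_one, one_mul] at this
  have h2 : y ^ orderOf x ∈ H y := (H y).pow_mem (hH.mem_self y) _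
  have h3 : x ∈ H y := by
    rw [← (H y).mul_mem_cancel_right (hH.mem_self y), ← hH.eq_of_mem_of_mem hne h1 h2]
    exact hH.mem_self _
  exact hy (hH.mem_symm h3 hx)

theorem IsPartitionMap.pow_orderOf_eq_one (hH : IsPartitionMap H) (hprop : ∀ x, x ≠ 1 → H x ≠ ⊤)
    (hcomm : ∀ x y : Γ, x * y = y * x) {x : Γ} (hx : x ≠ 1) (y : Γ) : y ^ orderOf x = 1 := by
  by_cases hy : y ∈ H x
  · by_cases hy1 : y = 1
    · simp [hy1]
    -- An element `z` of another part mediates: the order of `y` divides that of `z`, which divides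
    -- that of `x`.
    obtain ⟨z, hz, hz1⟩ := exists_notMem hprop hx
    have h1 := hH.pow_orderOf_eq_one_of_notMem hcomm hx hz
    have h2 : y ∉ H z := fun h => hz (by
      rw [← hH.eq_of_mem hy hy1, hH.eq_of_mem h hy1]
      exact hH.mem_self z)
    have h3 := hH.pow_orderOf_eq_one_of_notMem hcomm hz1 h2
    exact orderOf_dvd_iff_pow_eq_one.1
      ((orderOf_dvd_of_pow_eq_one h3).trans (orderOf_dvd_of_pow_eq_one h1))
  · exact hH.pow_orderOf_eq_one_of_notMem hcomm hx hy

theorem exists_addEquiv_pi_zmod {V : Type u} [AddCommGroup V] [Finite V] (p : ℕ) [Fact p.Prime]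
    [Module (ZMod p) V] : ∃ j : ℕ, Nonempty (V ≃+ (Fin j → ZMod p)) :=
  ⟨_, ⟨(Module.finBasis (ZMod p) V).equivFun.toAddEquiv⟩⟩

theorem exists_mulEquiv_of_pow_eq_one {A : Type u} [CommGroup A] [Finite A] {p : ℕ} (hp : p.Prime)
    (hpow : ∀ x : A, x ^ p = 1) :
    ∃ j : ℕ, Nonempty (A ≃* Multiplicative (Fin j → ZMod p)) := by
  have : Fact p.Prime := ⟨hp⟩
  let _ : Module (ZMod p) (Additive A) := AddCommGroup.zmodModule (n := p) fun x => by
    rw [← ofMul_toMul x, ← ofMul_pow, hpow]; rfl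
  have : Finite (Additive A) := Finite.of_equiv A Additive.ofMul
  obtain ⟨j, ⟨f⟩⟩ := exists_addEquiv_pi_zmod (V := Additive A) p
  exact ⟨j, ⟨AddEquiv.toMultiplicativeRight f⟩⟩

theorem IsPartitionMap.exists_mulEquiv [Finite Γ] [Nontrivial Γ] (hH : IsPartitionMap H)
    (hprop : ∀ x, x ≠ 1 → H x ≠ ⊤) (hconj : ∀ g x, g * x * g⁻¹ ∈ H x) :
    ∃ p j : ℕ, p.Prime ∧ 2 ≤ j ∧ Nonempty (Γ ≃* Multiplicative (Fin j → ZMod p)) := by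
  have hcomm := hH.commute hprop hconj
  obtain ⟨p, hp, hpd⟩ := Nat.exists_prime_and_dvd (Finite.one_lt_card (α := Γ)).ne'
  have : Fact p.Prime := ⟨hp⟩
  obtain ⟨x, hx⟩ := exists_prime_orderOf_dvd_card' p hpd
  have hx1 : x ≠ 1 := fun h => hp.one_lt.ne' (by rw [← hx, h, orderOf_one])
  obtain ⟨j, ⟨φ⟩⟩ := @exists_mulEquiv_of_pow_eq_one Γ
    { (inferInstance : Group Γ) with mul_comm := hcomm } _ p hp fun y => by
    rw [← hx]; exact hH.pow_orderOf_eq_one hprop hcomm hx1 y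
  refine ⟨p, j, hp, ?_, ⟨φ⟩⟩
  have hcard : Nat.card Γ = p ^ j := by
    rw [Nat.card_congr φ.toEquiv]
    simp
  -- If `j ≤ 1`, then `Γ` has prime order, so its only subgroups are trivial or everything, and `H
  -- x` is neither.
  by_contra hj
  have hdvd : Nat.card Γ ∣ p := by
    rw [hcard]
    exact (pow_dvd_pow p (by omega : j ≤ 1)).trans (by simp)
  have hcardp : Nat.card Γ = p :=
    ((Nat.dvd_prime hp).1 hdvd).resolve_left (Finite.one_lt_card (α := Γ)).ne'
  have : Fact (Nat.card Γ).Prime := ⟨by rwa [hcardp]⟩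
  rcases (H x).eq_bot_or_eq_top_of_prime_card with h | h
  · have h1 := hH.mem_self x
    rw [h, Subgroup.mem_bot] at h1
    exact hx1 h1
  · exact hprop x hx1 h

end Partitions

/-! ### Group structure forced by a non-elementary lift -/

section Forward

variable {n : ℕ} {Γ : Type u} [Group Γ] [Nontrivial Γ] {L : Matroid (GainEdge n Γ)}

theorem hasNontrivialGroupPartition_of_not_isElementaryLift (hn : 3 ≤ n)
    (hL : L ∈ balancedLifts n Γ)
    (hne : ¬ IsElementaryLift L (cycleMatroid (fullGainGraph n Γ))) :
    HasNontrivialGroupPartition Γ := by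
  have h01 : (⟨0, by omega⟩ : Fin n) ≠ ⟨1, by omega⟩ := by simp
  have h02 : (⟨0, by omega⟩ : Fin n) ≠ ⟨2, by omega⟩ := by simp
  have h12 : (⟨1, by omega⟩ : Fin n) ≠ ⟨2, by omega⟩ := by simp
  exact (isPartitionMap_spannedGains hL h01 h02 h12).hasNontrivialGroupPartition
    fun x hx h => hne (isElementaryLift_of_spannedGains_eq_top hL h01 h02 h12 hx h)

theorem exists_mulEquiv_of_not_isElementaryLift [Finite Γ] (hn : 4 ≤ n)
    (hL : L ∈ balancedLifts n Γ)
    (hne : ¬ IsElementaryLift L (cycleMatroid (fullGainGraph n Γ))) :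
    ∃ p j : ℕ, p.Prime ∧ 2 ≤ j ∧ Nonempty (Γ ≃* Multiplicative (Fin j → ZMod p)) := by
  have h01 : (⟨0, by omega⟩ : Fin n) ≠ ⟨1, by omega⟩ := by simp
  have h02 : (⟨0, by omega⟩ : Fin n) ≠ ⟨2, by omega⟩ := by simp
  have h12 : (⟨1, by omega⟩ : Fin n) ≠ ⟨2, by omega⟩ := by simp
  have h03 : (⟨0, by omega⟩ : Fin n) ≠ ⟨3, by omega⟩ := by simp
  have h13 : (⟨1, by omega⟩ : Fin n) ≠ ⟨3, by omega⟩ := by simp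
  have h23 : (⟨2, by omega⟩ : Fin n) ≠ ⟨3, by omega⟩ := by simp
  exact (isPartitionMap_spannedGains hL h01 h02 h12).exists_mulEquiv
    (fun x hx h => hne (isElementaryLift_of_spannedGains_eq_top hL h01 h02 h12 hx h))
    fun g x => conj_mem_spannedGains hL h01 h02 h12 h03 h13 h23 x g

end Forward

/-! ### Matroids of vector configurations -/

section VectorMatroid

variable (𝕜 : Type w) {V : Type v} {ι : Type u} [Field 𝕜] [AddCommGroup V] [Module 𝕜 V]

theorem LinearIndepOn.augment [Finite ι] {v : ι → V} {I J : Set ι} (hI : LinearIndepOn 𝕜 v I)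
    (hJ : LinearIndepOn 𝕜 v J) (hlt : I.ncard < J.ncard) :
    ∃ e ∈ J, e ∉ I ∧ LinearIndepOn 𝕜 v (insert e I) := by
  obtain ⟨e, heJ, he⟩ : ∃ e ∈ J, v e ∉ Submodule.span 𝕜 (v '' I) := by
    by_contra hcon
    push Not at hcon
    have hle : Submodule.span 𝕜 (v '' J) ≤ Submodule.span 𝕜 (v '' I) :=
      Submodule.span_le.2 (by
        rintro _ ⟨e, he, rfl⟩
        exact hcon e he)
    have hrank : ∀ K : Set ι, LinearIndepOn 𝕜 v K →
        Module.finrank 𝕜 (Submodule.span 𝕜 (v '' K)) = K.ncard := by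
      intro K hK
      have := K.toFinite.fintype
      have h1 := finrank_span_eq_card (R := 𝕜) (b := fun i : K => v i) hK
      rw [Set.image_eq_range, h1, ← Nat.card_eq_fintype_card, Nat.card_coe_set_eq]
    have : Module.Finite 𝕜 (Submodule.span 𝕜 (v '' I)) :=
      FiniteDimensional.span_of_finite _ (I.toFinite.image _)
    have h2 := Submodule.finrank_mono hle
    rw [hrank I hI, hrank J hJ] at h2
    omega
  have heI : e ∉ I := fun h => he (Submodule.subset_span ⟨e, h, rfl⟩)
  exact ⟨e, heJ, heI, (linearIndepOn_insert heI).2 ⟨hI, he⟩⟩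

/-- The matroid of a finite family of vectors. -/
def vectorMatroid [Finite ι] (v : ι → V) : Matroid ι :=
  (IndepMatroid.ofFinite (E := Set.univ) Set.finite_univ (LinearIndepOn 𝕜 v)
    (linearIndepOn_empty 𝕜 v) (fun _ _ hJ hIJ => hJ.mono hIJ)
    (fun _ _ hI hJ hlt => LinearIndepOn.augment 𝕜 hI hJ hlt) (fun _ _ => Set.subset_univ _)).matroid

theorem vectorMatroid_indep_iff [Finite ι] (v : ι → V) {I : Set ι} :
    (vectorMatroid 𝕜 v).Indep I ↔ LinearIndepOn 𝕜 v I := Iff.rfl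

theorem linearIndepOn_image_iff {κ : Type*} {v : ι → V} {f : κ → ι} (hf : Function.Injective f)
    (s : Set κ) : LinearIndepOn 𝕜 v (f '' s) ↔ LinearIndepOn 𝕜 (v ∘ f) s :=
  (linearIndependent_equiv' (Equiv.Set.image f s hf) rfl).symm

/-- Contracting `s` in a vector matroid means passing to the quotient by the span of `s`; `g` plays
the role of the quotient map. -/
theorem linearIndepOn_union_iff_of_ker {W : Type*} [AddCommGroup W] [Module 𝕜 W] {v : ι → V}
    {s t : Set ι} (hdj : Disjoint t s) (hs : LinearIndepOn 𝕜 v s) (g : V →ₗ[𝕜] W)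
    (hg : LinearMap.ker g = Submodule.span 𝕜 (v '' s)) :
    LinearIndepOn 𝕜 v (t ∪ s) ↔ LinearIndepOn 𝕜 (g ∘ v) t := by
  rw [linearIndepOn_union_iff hdj, and_iff_right hs, ← hg]
  constructor
  · rintro ⟨ht, hd⟩
    refine LinearIndependent.map ht ?_
    rwa [← Set.image_eq_range]
  · intro h
    refine ⟨h.of_comp g, ?_⟩
    have := Submodule.range_ker_disjoint (f := g) (v := fun i : t => v i) h
    rwa [← Set.image_eq_range] at this

end VectorMatroid

/-! ### The linear lift of the full gain graph of an elementary abelian group -/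

section LinearLift

variable {n j : ℕ} {Γ : Type u} {𝕜 : Type w} [Field 𝕜]

/-- The incidence vector of an edge, oriented towards its larger end. -/
def orientedIncVec (𝕜 : Type w) [Field 𝕜] (e : GainEdge n Γ) : Fin n → 𝕜 :=
  Pi.single e.1.1.2 1 - Pi.single e.1.1.1 1

/-- The sign of an edge traversed starting from `x`. -/
def traversalSign (𝕜 : Type w) [Field 𝕜] (e : GainEdge n Γ) (x : Fin n) : 𝕜ˣ :=
  if x = e.1.1.1 then 1 else -1

theorem traversalSign_smul_orientedIncVec {e : GainEdge n Γ} {x y : Fin n}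
    (h : (fullGainGraph n Γ).IsLink e x y) :
    traversalSign 𝕜 e x • orientedIncVec 𝕜 e = Pi.single y 1 - Pi.single x 1 := by
  rcases h with ⟨rfl, rfl⟩ | ⟨rfl, rfl⟩
  · simp [traversalSign, orientedIncVec]
  · simp [traversalSign, orientedIncVec, e.1.2.ne']

/-- Only the terms `i` and `i + 1` involve the vertex `v (i + 1)`, so that coordinate equates their
coefficients. A cycle thus has a single dependency up to scale. -/
theorem coeff_eq_of_cyclic {m : ℕ} {v : Fin (m + 1) → Fin n} (hv : Function.Injective v)
    {c : Fin (m + 1) → 𝕜}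
    (hc : ∑ i, c i • (Pi.single (v (i + 1)) 1 - Pi.single (v i) 1 : Fin n → 𝕜) = 0)
    (i : Fin (m + 1)) : c i = c 0 := by
  have hstep : ∀ i, c (i + 1) = c i := by
    intro i
    have h1 := congrFun hc (v (i + 1))
    simp only [Finset.sum_apply, Pi.smul_apply, Pi.sub_apply, Pi.single_apply, hv.eq_iff,
      smul_eq_mul, mul_sub, mul_ite, mul_one, mul_zero, Finset.sum_sub_distrib,
      add_left_inj, Finset.sum_ite_eq, Finset.mem_univ, if_true, Pi.zero_apply] at h1
    exact (sub_eq_zero.1 h1).symm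
  induction i using Fin.induction with
  | zero => rfl
  | succ i ih => rw [← ih, ← hstep i.castSucc, Fin.coeSucc_eq_succ]

theorem sum_cyclic {m : ℕ} (v : Fin (m + 1) → Fin n) :
    ∑ i, (Pi.single (v (i + 1)) 1 - Pi.single (v i) 1 : Fin n → 𝕜) = 0 := by
  rw [Finset.sum_sub_distrib, sub_eq_zero]
  exact Equiv.sum_comp (Equiv.addRight (1 : Fin (m + 1)))
    (fun i => (Pi.single (v i) 1 : Fin n → 𝕜))

theorem linearIndepOn_orientedIncVec_iff {I : Set (GainEdge n Γ)} :
    LinearIndepOn 𝕜 (orientedIncVec 𝕜) I ↔ IsAcyclicSet (fullGainGraph n Γ) I := by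
  classical
  constructor
  · refine fun hI => ⟨Set.subset_univ _, ?_⟩
    rintro C hCI ⟨m, v, e, hw, rfl⟩
    have h1 : LinearIndependent 𝕜 (orientedIncVec 𝕜 ∘ e) :=
      (linearIndepOn_range_iff hw.edge_injective _).1 (hI.mono hCI)
    have h2 := h1.units_smul fun i => traversalSign 𝕜 (e i) (v i)
    have h3 := Fintype.linearIndependent_iff.1 h2 (fun _ => 1) (by
      rw [← sum_cyclic (𝕜 := 𝕜) v]
      refine Finset.sum_congr rfl fun i _ => ?_
      rw [one_smul]
      exact traversalSign_smul_orientedIncVec (hw.isLink i)) 0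
    exact one_ne_zero h3
  · intro hI
    by_contra hcon
    rw [linearIndepOn_iff'] at hcon
    push Not at hcon
    obtain ⟨t, g, htI, hsum, e₀, he₀, hge₀⟩ := hcon
    let D : Finset (GainEdge n Γ) := t.filter (fun e => g e ≠ 0)
    have hDt : ∀ e ∈ D, e ∈ t := fun e he => (Finset.mem_filter.1 he).1
    have hsumD : ∑ e ∈ D, g e • orientedIncVec 𝕜 e = 0 := by
      rw [← hsum, Finset.sum_filter]
      refine Finset.sum_congr rfl fun e _ => ?_
      by_cases h : g e = 0 <;> simp [h]
    -- In the support of a dependency, every end of an edge meets another edge of the support, for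
    -- otherwise its coordinate would not cancel. Such a set contains a cycle.
    obtain ⟨C, hCD, hC⟩ := exists_isCycle_of_step (G := fullGainGraph n Γ) (D := D) D.finite_toSet
      ⟨e₀, by simp [D, he₀, hge₀]⟩ (Set.subset_univ _) (by
        intro e he x y hl
        by_contra hno
        push Not at hno
        have h1 := congrFun hsumD y
        rw [Finset.sum_apply, Finset.sum_eq_single_of_mem e he] at h1
        · have hge : g e ≠ 0 := (Finset.mem_filter.1 he).2
          have hlt := e.1.2.ne
          rcases hl with ⟨rfl, rfl⟩ | ⟨rfl, rfl⟩
          · simp [orientedIncVec, hlt.symm, hge] at h1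
          · simp [orientedIncVec, hlt, hge] at h1
        · intro e' he' hne
          have h2 : y ≠ e'.1.1.1 := fun h => hno e' he' hne e'.1.1.2 (Or.inl ⟨h, rfl⟩)
          have h3 : y ≠ e'.1.1.2 := fun h => hno e' he' hne e'.1.1.1 (Or.inr ⟨h, rfl⟩)
          simp [orientedIncVec, h2, h3])
    exact hI.2 C (fun e he => htI (hDt e (hCD he))) hC

variable [Group Γ]

/-- The vectors representing the linear lift: an edge of gain `γ` is represented by its incidence
vector together with the coordinates of `γ`, and the further elements by the unit vectors. -/
def gainVec (φ : Γ →* Multiplicative (Fin j → 𝕜)) :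
    GainEdge n Γ ⊕ Fin j → (Fin n → 𝕜) × (Fin j → 𝕜) :=
  Sum.elim (fun e => (orientedIncVec 𝕜 e, (φ e.2).toAdd)) (fun k => (0, Pi.single k 1))

variable {φ : Γ →* Multiplicative (Fin j → 𝕜)}

theorem traversalSign_smul_gainVec {e : GainEdge n Γ} {x y : Fin n}
    (h : (fullGainGraph n Γ).IsLink e x y) :
    traversalSign 𝕜 e x • gainVec φ (Sum.inl e) =
      (Pi.single y 1 - Pi.single x 1, (φ (gainFrom e x)).toAdd) := by
  refine Prod.ext (traversalSign_smul_orientedIncVec h) ?_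
  simp only [gainVec, Sum.elim_inl, Prod.smul_snd, traversalSign, gainFrom]
  split_ifs <;> simp

theorem linearIndepOn_gainVec_inr :
    LinearIndepOn 𝕜 (gainVec (n := n) φ) (Set.range Sum.inr) := by
  rw [linearIndepOn_range_iff Sum.inr_injective]
  have h1 : LinearIndependent 𝕜 (fun k : Fin j => (Pi.single k 1 : Fin j → 𝕜)) := by
    have h2 := (Pi.basisFun 𝕜 (Fin j)).linearIndependent
    rwa [show ⇑(Pi.basisFun 𝕜 (Fin j)) = fun k => Pi.single k 1 from
      funext fun k => Pi.basisFun_apply 𝕜 (Fin j) k] at h2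
  exact LinearIndependent.of_comp (LinearMap.snd 𝕜 (Fin n → 𝕜) (Fin j → 𝕜)) h1

theorem span_gainVec_inr : LinearMap.ker (LinearMap.fst 𝕜 (Fin n → 𝕜) (Fin j → 𝕜)) =
    Submodule.span 𝕜 (gainVec (n := n) φ '' Set.range Sum.inr) := by
  apply le_antisymm
  · rintro ⟨a, b⟩ h
    obtain rfl : a = 0 := h
    have h1 : ((0, b) : (Fin n → 𝕜) × (Fin j → 𝕜)) =
        ∑ k, b k • gainVec (n := n) φ (Sum.inr k) := by
      refine Prod.ext ?_ ?_
      · simp [gainVec, Prod.fst_sum]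
      · ext k
        simp [gainVec, Prod.snd_sum, Finset.sum_apply, Pi.single_apply]
    rw [h1]
    exact Submodule.sum_mem _ fun k _ => Submodule.smul_mem _ _
      (Submodule.subset_span ⟨_, ⟨k, rfl⟩, rfl⟩)
  · rw [Submodule.span_le]
    rintro _ ⟨_, ⟨k, rfl⟩, rfl⟩
    rfl

theorem linearIndepOn_gainVec_iff {I : Set (GainEdge n Γ)} :
    LinearIndepOn 𝕜 (gainVec φ) (Sum.inl '' I ∪ Set.range Sum.inr) ↔
      IsAcyclicSet (fullGainGraph n Γ) I := by
  have hdj : Disjoint (Sum.inl '' I) (Set.range (Sum.inr : Fin j → GainEdge n Γ ⊕ Fin j)) := by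
    rw [Set.disjoint_left]
    rintro _ ⟨x, -, rfl⟩ ⟨y, hy⟩
    cases hy
  rw [linearIndepOn_union_iff_of_ker 𝕜 hdj linearIndepOn_gainVec_inr _ span_gainVec_inr,
    ← linearIndepOn_orientedIncVec_iff (𝕜 := 𝕜), linearIndepOn_image_iff 𝕜 Sum.inl_injective]
  rfl

theorem sum_gains_eq {m : ℕ} (v : Fin (m + 1) → Fin n) (e : Fin (m + 1) → GainEdge n Γ) :
    ∑ i, (φ (gainFrom (e i) (v i))).toAdd =
      (φ (List.ofFn fun i => gainFrom (e i) (v i)).prod).toAdd := by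
  rw [map_list_prod, List.map_ofFn, List.prod_ofFn, toAdd_prod]
  rfl

variable [Finite Γ]

/-- The lift of the cycle matroid represented by the vectors `gainVec`. -/
noncomputable def linearLift (n : ℕ) (φ : Γ →* Multiplicative (Fin j → 𝕜)) : Matroid (GainEdge n Γ) :=
  (vectorMatroid 𝕜 (gainVec (n := n) φ)).comap Sum.inl

theorem linearLift_indep_iff {I : Set (GainEdge n Γ)} :
    (linearLift n φ).Indep I ↔ LinearIndepOn 𝕜 (gainVec φ ∘ Sum.inl) I := by
  rw [linearLift, Matroid.comap_indep_iff, vectorMatroid_indep_iff,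
    and_iff_left Sum.inl_injective.injOn, linearIndepOn_image_iff 𝕜 Sum.inl_injective]

theorem isLift_linearLift : IsLift (linearLift n φ) (cycleMatroid (fullGainGraph n Γ)) := by
  refine isLift_comap_inl rfl linearIndepOn_gainVec_inr (fun I => ?_) rfl
  rw [cycleMatroid_indep_iff, vectorMatroid_indep_iff, linearIndepOn_gainVec_iff]

theorem linearLift_mem_balancedLifts (hφ : Function.Injective φ) :
    linearLift n φ ∈ balancedLifts n Γ := by
  refine ⟨isLift_linearLift, fun C hC => ?_⟩
  -- A nontrivial dependency along a cycle is, up to signs, a multiple of the all-ones one. Its gain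
  -- part is that multiple of the image of the gain product, so the product is trivial by
  -- injectivity. That no coefficient vanishes gives minimality of the circuit later.
  have hdep : ∀ {m : ℕ} {v : Fin (m + 1) → Fin n} {e : Fin (m + 1) → GainEdge n Γ},
      IsCyclicWalk (fullGainGraph n Γ) v e → ∀ c : Fin (m + 1) → 𝕜,
      ∑ i, c i • (gainVec φ (Sum.inl (e i))) = 0 → (∃ i, c i ≠ 0) →
      (∀ i, c i ≠ 0) ∧ (List.ofFn fun i => gainFrom (e i) (v i)).prod = 1 := by
    intro m v e hw c hc hne
    -- Coefficients with all edges reoriented along the walk.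
    obtain ⟨d, hd⟩ : ∃ d : Fin (m + 1) → 𝕜, ∀ i, c i = d i * (traversalSign 𝕜 (e i) (v i) : 𝕜) :=
      ⟨fun i => c i * ((traversalSign 𝕜 (e i) (v i))⁻¹ : 𝕜ˣ), fun i => by
        rw [mul_assoc, Units.inv_mul, mul_one]⟩
    have h1 : ∑ i, d i • ((Pi.single (v (i + 1)) 1 - Pi.single (v i) 1,
        (φ (gainFrom (e i) (v i))).toAdd) : (Fin n → 𝕜) × (Fin j → 𝕜)) = 0 := by
      rw [← hc]
      refine Finset.sum_congr rfl fun i _ => ?_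
      rw [← traversalSign_smul_gainVec (φ := φ) (hw.isLink i), hd, mul_smul, Units.smul_def]
    have h2 : ∀ i, d i = d 0 := coeff_eq_of_cyclic hw.vert_injective (by
      have h3 := congrArg Prod.fst h1
      rw [Prod.fst_sum] at h3
      exact h3)
    have h0 : d 0 ≠ 0 := by
      intro h0
      obtain ⟨i, hi⟩ := hne
      exact hi (by rw [hd, h2, h0, zero_mul])
    refine ⟨fun i => by rw [hd, h2]; exact mul_ne_zero h0 (Units.ne_zero _), ?_⟩
    have h4 := congrArg Prod.snd h1
    rw [Prod.snd_sum, Finset.sum_congr rfl fun i _ => by rw [h2 i, Prod.smul_snd],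
      ← Finset.smul_sum, sum_gains_eq] at h4
    have h5 := (smul_eq_zero.1 h4).resolve_left h0
    exact hφ (by rw [map_one]; exact h5)
  constructor
  · obtain ⟨m, v, e, hw, rfl⟩ := hC
    intro hcirc
    have h1 := hcirc.not_indep
    rw [linearLift_indep_iff, linearIndepOn_range_iff hw.edge_injective,
      Fintype.linearIndependent_iff] at h1
    push Not at h1
    obtain ⟨c, hc, hne⟩ := h1
    exact ⟨m, v, e, hw, rfl, (hdep hw c hc hne).2⟩
  · rintro ⟨m, v, e, hw, rfl, hprod⟩
    rw [Matroid.isCircuit_iff_dep_forall_sdiff_singleton_indep]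
    refine ⟨⟨?_, Set.subset_univ _⟩, ?_⟩
    · rw [linearLift_indep_iff, linearIndepOn_range_iff hw.edge_injective]
      intro hind
      have h2 := hind.units_smul fun i => traversalSign 𝕜 (e i) (v i)
      refine one_ne_zero (Fintype.linearIndependent_iff.1 h2 (fun _ => 1) ?_ 0)
      have h3 : ∀ i, (1 : 𝕜) • ((fun i => traversalSign 𝕜 (e i) (v i)) •
          ((gainVec φ ∘ Sum.inl) ∘ e)) i =
          ((Pi.single (v (i + 1)) 1 - Pi.single (v i) 1, (φ (gainFrom (e i) (v i))).toAdd) :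
          (Fin n → 𝕜) × (Fin j → 𝕜)) := fun i => by
        rw [one_smul]
        exact traversalSign_smul_gainVec (hw.isLink i)
      rw [Finset.sum_congr rfl fun i _ => h3 i]
      refine Prod.ext ?_ ?_
      · rw [Prod.fst_sum]; exact sum_cyclic v
      · rw [Prod.snd_sum, sum_gains_eq, hprod, map_one]; rfl
    · rintro _ ⟨k, rfl⟩
      have himage : Set.range e \ {e k} = e '' {k}ᶜ := by
        rw [Set.image_compl_eq_range_sdiff_image hw.edge_injective, Set.image_singleton]
      rw [linearLift_indep_iff, himage, linearIndepOn_image_iff 𝕜 hw.edge_injective,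
        linearIndepOn_iff']
      intro t g ht hg i hi
      by_contra hgi
      -- Extended by zero, a dependency avoiding the edge `k` has a vanishing coefficient there,
      -- contrary to `hdep`.
      refine (hdep hw (fun i => if i ∈ t then g i else 0) ?_ ⟨i, by simpa [hi] using hgi⟩).1 k ?_
      · rw [← hg]
        simp [ite_smul, Finset.sum_ite_mem]
      · exact if_neg fun hk => ht hk rfl

end LinearLift

/-! ### Non-elementary lifts for elementary abelian groups -/

section LinearLift

variable {n : ℕ} {Γ : Type u} [Group Γ] [Finite Γ]

theorem exists_nonelementary_of_mulEquiv (hn : 2 ≤ n) {p j : ℕ} (hp : p.Prime) (hj : 2 ≤ j)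
    (φ : Γ ≃* Multiplicative (Fin j → ZMod p)) :
    ∃ L ∈ balancedLifts n Γ, ¬ IsElementaryLift L (cycleMatroid (fullGainGraph n Γ)) := by
  have : Fact p.Prime := ⟨hp⟩
  have h01 : (⟨0, by omega⟩ : Fin n) ≠ ⟨1, by omega⟩ := by simp
  let k₀ : Fin j := ⟨0, by omega⟩
  let k₁ : Fin j := ⟨1, by omega⟩
  have hk : k₀ ≠ k₁ := by simp [k₀, k₁]
  let x : Γ := φ.symm (Multiplicative.ofAdd (Pi.single k₀ 1))
  let y : Γ := φ.symm (Multiplicative.ofAdd (Pi.single k₁ 1))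
  have hx : (φ x).toAdd = Pi.single k₀ 1 := by simp [x]
  have hy : (φ y).toAdd = Pi.single k₁ 1 := by simp [y]
  have hL := linearLift_mem_balancedLifts (n := n) (φ := φ.toMonoidHom) φ.injective
  refine ⟨_, hL, ?_⟩
  have hx1 : x ≠ 1 := by
    intro h
    rw [h, map_one] at hx
    simpa using congrFun hx k₀
  have hy1 : y ≠ 1 := by
    intro h
    rw [h, map_one] at hy
    simpa using congrFun hy k₁
  have hxy : x ≠ y := by
    intro h
    rw [← h, hx] at hy
    simpa [hk] using congrFun hy k₀
  refine not_isElementaryLift_of_indep hL h01 hx1 hy1 hxy ?_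
  have hinj : Function.Injective ![gainEdge h01 y, gainEdge h01 x, gainEdge h01 1] := by
    have h1 : gainEdge h01 y ≠ gainEdge h01 x := fun h => hxy (gainEdge_injective h01 h).symm
    have h2 : gainEdge h01 y ≠ gainEdge h01 1 := fun h => hy1 (gainEdge_injective h01 h)
    have h3 : gainEdge h01 x ≠ gainEdge h01 1 := fun h => hx1 (gainEdge_injective h01 h)
    intro a b h
    fin_cases a <;> fin_cases b
    exacts [rfl, absurd h h1, absurd h h2, absurd h h1.symm, rfl, absurd h h3,
      absurd h h2.symm, absurd h h3.symm, rfl]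
  rw [← range_triangle, linearLift_indep_iff, linearIndepOn_range_iff hinj,
    Fintype.linearIndependent_iff]
  intro c hc
  rw [Fin.sum_univ_three] at hc
  have hv : ∀ γ : Γ, gainVec φ.toMonoidHom (Sum.inl (gainEdge h01 γ)) =
      (Pi.single ⟨1, by omega⟩ 1 - Pi.single ⟨0, by omega⟩ 1, (φ γ).toAdd) := by
    intro γ
    simp [gainEdge, gainVec, orientedIncVec]
  have hc' : c 0 • gainVec φ.toMonoidHom (Sum.inl (gainEdge h01 y)) +
      c 1 • gainVec φ.toMonoidHom (Sum.inl (gainEdge h01 x)) +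
      c 2 • gainVec φ.toMonoidHom (Sum.inl (gainEdge h01 1)) = 0 := hc
  rw [hv, hv, hv, hx, hy, map_one] at hc'
  -- The gain coordinates `k₁` and `k₀` isolate the coefficients of `y` and `x`; the incidence part
  -- then isolates that of the edge of gain `1`.
  have h0 : c 0 = 0 := by simpa [hk, hk.symm] using congrFun (congrArg Prod.snd hc') k₁
  have h1 : c 1 = 0 := by simpa [hk, hk.symm] using congrFun (congrArg Prod.snd hc') k₀
  have h2 : c 2 = 0 := by
    simpa [h0, h1, h01, h01.symm] using congrFun (congrArg Prod.fst hc') ⟨1, by omega⟩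
  intro i
  fin_cases i
  exacts [h0, h1, h2]

end LinearLift

/-! ### The rank-four geometry of a conjugation-invariant group partition -/

section Geometry

variable {Γ : Type u} [Group Γ]

/-- The gain of an edge of the directed triangle after switching by `g`. -/
def switchedGain (g : Fin 3 → Γ) (q : Fin 3 × Γ) : Γ := g q.1 * q.2 * (g (q.1 + 1))⁻¹

/-- All edges of one parallel class, together with the two further points. -/
def parallelPlane (Γ : Type u) (i : Fin 3) : Set ((Fin 3 × Γ) ⊕ Fin 2) :=
  {p | Sum.elim (fun q => q.1 = i) (fun _ => True) p}

/-- A balanced triangle, together with one of the two further points. -/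
def trianglePlane (g : Fin 3 → Γ) (f : Fin 2) : Set ((Fin 3 × Γ) ⊕ Fin 2) :=
  {p | Sum.elim (fun q => switchedGain g q = 1) (fun k => k = f) p}

/-- The edges whose gain after switching by `g` lies in the subgroup `K`. -/
def subgroupPlane (g : Fin 3 → Γ) (K : Subgroup Γ) : Set ((Fin 3 × Γ) ⊕ Fin 2) :=
  {p | Sum.elim (fun q => switchedGain g q ∈ K) (fun _ => False) p}

/-- The planes of the geometry defined by a partition map. -/
def IsPlane (H : Γ → Subgroup Γ) (P : Set ((Fin 3 × Γ) ⊕ Fin 2)) : Prop :=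
  (∃ i, P = parallelPlane Γ i) ∨ (∃ g f, P = trianglePlane g f) ∨
    ∃ g h, h ≠ 1 ∧ P = subgroupPlane g (H h)

/-- The subset `S` is contained in a plane. -/
def Coplanar (H : Γ → Subgroup Γ) (S : Set ((Fin 3 × Γ) ⊕ Fin 2)) : Prop :=
  ∃ P, IsPlane H P ∧ S ⊆ P

/-- The subset `T` lies in a balanced triangle, or in a coset in one parallel class. -/
def Collinear (H : Γ → Subgroup Γ) (T : Set ((Fin 3 × Γ) ⊕ Fin 2)) : Prop :=
  (∃ g, ∀ p ∈ T, ∃ q, p = Sum.inl q ∧ switchedGain g q = 1) ∨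
    ∃ i g h, h ≠ 1 ∧ ∀ p ∈ T, ∃ q, p = Sum.inl q ∧ q.1 = i ∧ switchedGain g q ∈ H h

variable {H : Γ → Subgroup Γ}

theorem fin_three_add_one_ne : ∀ i : Fin 3, i + 1 ≠ i := by decide

theorem fin_three_add_add_ne : ∀ i : Fin 3, i + 1 + 1 ≠ i := by decide

theorem fin_three_add_add_add : ∀ i : Fin 3, i + 1 + 1 + 1 = i := by decide

theorem fin_three_cases : ∀ i k : Fin 3, k = i ∨ k = i + 1 ∨ k = i + 1 + 1 := by decide

theorem fin_three_adjacent : ∀ {i j : Fin 3}, i ≠ j → j = i + 1 ∨ i = j + 1 := by decide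

theorem fin_three_const {α : Type*} {f : Fin 3 → α} {i j : Fin 3} (hij : i ≠ j)
    (hi : f i = f (i + 1)) (hj : f j = f (j + 1)) (a b : Fin 3) : f a = f b := by
  have main : ∀ i : Fin 3, f i = f (i + 1) → f (i + 1) = f (i + 1 + 1) → ∀ k, f k = f i := by
    intro i h1 h2 k
    rcases fin_three_cases i k with rfl | rfl | rfl
    exacts [rfl, h1.symm, (h1.trans h2).symm]
  rcases fin_three_adjacent hij with rfl | rfl
  · exact (main i hi hj a).trans (main i hi hj b).symm
  · exact (main j hj hi a).trans (main j hj hi b).symm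

/-- Changing `g` at the vertex opposite the class `i` leaves that class alone, and every edge of
another class ends at that vertex, so it can be balanced. -/
theorem exists_switching_of_ne (g : Fin 3 → Γ) {i : Fin 3} {q : Fin 3 × Γ} (hq : q.1 ≠ i) :
    ∃ g' : Fin 3 → Γ, switchedGain g' q = 1 ∧
      ∀ z, switchedGain g' (i, z) = switchedGain g (i, z) := by
  obtain ⟨j, w⟩ := q
  have h1 := fin_three_add_one_ne i
  have h2 := fin_three_add_add_ne i
  have h3 := fin_three_add_one_ne (i + 1)
  rcases fin_three_cases i j with rfl | rfl | rfl
  · exact absurd rfl hq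
  · refine ⟨Function.update g (i + 1 + 1) (g (i + 1) * w), ?_, fun z => ?_⟩
    · simp [switchedGain, h3.symm]
    · simp [switchedGain, h2.symm, h3.symm]
  · refine ⟨Function.update g (i + 1 + 1) (g i * w⁻¹), ?_, fun z => ?_⟩
    · simp [switchedGain, h2.symm, fin_three_add_add_add]
    · simp [switchedGain, h2.symm, h3.symm]

theorem IsPartitionMap.coplanar_insert (hH : IsPartitionMap H) {T : Set ((Fin 3 × Γ) ⊕ Fin 2)}
    (hT : Collinear H T) (y : (Fin 3 × Γ) ⊕ Fin 2) : Coplanar H (insert y T) := by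
  rcases hT with ⟨g, hg⟩ | ⟨i, g, h, hh, hg⟩
  · have htri : ∀ f, T ⊆ trianglePlane g f := by
      intro f p hp
      obtain ⟨q, rfl, hq⟩ := hg p hp
      exact hq
    rcases y with q | f
    · by_cases hq : switchedGain g q = 1
      · exact ⟨_, Or.inr (Or.inl ⟨g, 0, rfl⟩), Set.insert_subset hq (htri 0)⟩
      -- The plane comes from the part that contains the switched gain of the new edge; the balanced
      -- edges have label `1`, which lies in every part's subgroup.
      · refine ⟨_, Or.inr (Or.inr ⟨g, _, hq, rfl⟩), Set.insert_subset (hH.mem_self _) ?_⟩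
        intro p hp
        obtain ⟨q', rfl, hq'⟩ := hg p hp
        change switchedGain g q' ∈ H (switchedGain g q)
        rw [hq']
        exact one_mem _
    · exact ⟨_, Or.inr (Or.inl ⟨g, f, rfl⟩), Set.insert_subset rfl (htri f)⟩
  · have hcls : T ⊆ parallelPlane Γ i := by
      intro p hp
      obtain ⟨q, rfl, hq, -⟩ := hg p hp
      exact hq
    rcases y with q | f
    · by_cases hq : q.1 = i
      · exact ⟨_, Or.inl ⟨i, rfl⟩, Set.insert_subset hq hcls⟩
      · obtain ⟨g', hg'q, hg'⟩ := exists_switching_of_ne g hq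
        refine ⟨_, Or.inr (Or.inr ⟨g', h, hh, rfl⟩), Set.insert_subset ?_ ?_⟩
        · change switchedGain g' q ∈ H h
          rw [hg'q]
          exact one_mem _
        · intro p hp
          obtain ⟨⟨i', z⟩, rfl, rfl, hz⟩ := hg p hp
          change switchedGain g' (i', z) ∈ H h
          rwa [hg']
    · exact ⟨_, Or.inl ⟨i, rfl⟩, Set.insert_subset trivial hcls⟩

/-- Two switchings that balance edges of two parallel classes differ by a constant. -/
theorem switchedGain_conj {g g' : Fin 3 → Γ} {q q' : Fin 3 × Γ} (hne : q.1 ≠ q'.1)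
    (h1 : switchedGain g q = 1) (h2 : switchedGain g' q = 1) (h3 : switchedGain g q' = 1)
    (h4 : switchedGain g' q' = 1) :
    ∃ c, ∀ r, switchedGain g' r = c * switchedGain g r * c⁻¹ := by
  -- If both switchings balance an edge, their quotient agrees at its two ends; edges of two classes
  -- connect all three vertices.
  have key : ∀ r : Fin 3 × Γ, switchedGain g r = 1 → switchedGain g' r = 1 →
      g' r.1 * (g r.1)⁻¹ = g' (r.1 + 1) * (g (r.1 + 1))⁻¹ := by
    intro r hr hr'
    have e1 : g r.1 * r.2 = g (r.1 + 1) := mul_inv_eq_one.1 hr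
    have e2 : g' r.1 * r.2 = g' (r.1 + 1) := mul_inv_eq_one.1 hr'
    rw [← e1, ← e2]
    group
  have hk := key q h1 h2
  have hk' := key q' h3 h4
  obtain ⟨i, z⟩ := q
  obtain ⟨i', z'⟩ := q'
  have hconst : ∀ a b : Fin 3, g' a * (g a)⁻¹ = g' b * (g b)⁻¹ := by
    exact fin_three_const (f := fun a => g' a * (g a)⁻¹) hne hk hk'
  refine ⟨g' 0 * (g 0)⁻¹, fun r => ?_⟩
  have e1 : g' r.1 = g' 0 * (g 0)⁻¹ * g r.1 := by rw [hconst 0 r.1]; group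
  have e2 : g' (r.1 + 1) = g' 0 * (g 0)⁻¹ * g (r.1 + 1) := by rw [hconst 0 (r.1 + 1)]; group
  simp only [switchedGain]
  rw [e1, e2]
  group

/-- Multiplying `g` on the left by values in `K` multiplies each label on both sides by elements of
`K`, so the plane is unchanged. The partial products of the labels along the two edges balance both.
-/
theorem exists_switching_mem {K : Subgroup Γ} {g : Fin 3 → Γ} {q q' : Fin 3 × Γ}
    (hne : q.1 ≠ q'.1) (hq : switchedGain g q ∈ K) (hq' : switchedGain g q' ∈ K) :
    ∃ g', switchedGain g' q = 1 ∧ switchedGain g' q' = 1 ∧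
      subgroupPlane g' K = subgroupPlane g K := by
  have main : ∀ (i : Fin 3) (z z' : Γ), switchedGain g (i, z) ∈ K →
      switchedGain g (i + 1, z') ∈ K → ∃ g', switchedGain g' (i, z) = 1 ∧
      switchedGain g' (i + 1, z') = 1 ∧ subgroupPlane g' K = subgroupPlane g K := by
    intro i z z' hz hz'
    have h1 := fin_three_add_one_ne i
    have h2 := fin_three_add_add_ne i
    have h3 := fin_three_add_one_ne (i + 1)
    set a : Fin 3 → Γ := fun k => if k = i then 1 else if k = i + 1 then switchedGain g (i, z)
      else switchedGain g (i, z) * switchedGain g (i + 1, z') with ha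
    have haK : ∀ k, a k ∈ K := by
      intro k
      simp only [ha]
      split_ifs
      exacts [one_mem _, hz, mul_mem hz hz']
    have hlab : ∀ q, switchedGain (fun k => a k * g k) q =
        a q.1 * switchedGain g q * (a (q.1 + 1))⁻¹ := by
      intro q
      simp only [switchedGain]
      group
    refine ⟨fun k => a k * g k, ?_, ?_, ?_⟩
    · rw [hlab]; simp [ha, h1]
    · rw [hlab]; simp [ha, h1, h2, h3]
    · ext p
      rcases p with q | f
      · change switchedGain _ q ∈ K ↔ switchedGain g q ∈ K
        rw [hlab, Subgroup.mul_mem_cancel_right _ (inv_mem (haK _)),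
          Subgroup.mul_mem_cancel_left _ (haK _)]
      · exact Iff.rfl
  obtain ⟨i, z⟩ := q
  obtain ⟨i', z'⟩ := q'
  rcases fin_three_adjacent hne with rfl | rfl
  · exact main i z z' hq hq'
  · obtain ⟨g', h1, h2, h3⟩ := main i' z' z hq' hq
    exact ⟨g', h2, h1, h3⟩

/-- A parallel plane shares at most two points with another parallel plane or with a triangle plane.
In all other cases the common triple is compared through switchings. -/
theorem IsPartitionMap.collinear_of_subset_of_subset (hH : IsPartitionMap H)
    (hconj : ∀ g x y, y ∈ H x → g * y * g⁻¹ ∈ H (g * x * g⁻¹))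
    {T P Q : Set ((Fin 3 × Γ) ⊕ Fin 2)} (hT : T.ncard = 3) (hP : IsPlane H P) (hQ : IsPlane H Q)
    (hPQ : P ≠ Q) (hTP : T ⊆ P) (hTQ : T ⊆ Q) : Collinear H T := by
  have hle : ∀ a b, T ⊆ {a, b} → False := by
    intro a b h
    have h1 := Set.ncard_le_ncard h (Set.toFinite _)
    have h2 := Set.ncard_insert_le a {b}
    rw [Set.ncard_singleton] at h2
    omega
  have hPT : ∀ (i : Fin 3) g f, T ⊆ parallelPlane Γ i → T ⊆ trianglePlane g f → False := by
    intro i g f h1 h2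
    refine hle (Sum.inl (i, (g i)⁻¹ * g (i + 1))) (Sum.inr f) fun p hp => ?_
    rcases p with ⟨i', z⟩ | k
    · have e1 : i' = i := h1 hp
      subst e1
      have e2 : g i' * z * (g (i' + 1))⁻¹ = 1 := h2 hp
      left
      rw [mul_inv_eq_one] at e2
      rw [← e2, inv_mul_cancel_left]
    · have e1 : k = f := h2 hp
      rw [e1]; simp
  have hPS : ∀ (i : Fin 3) g h, h ≠ 1 → T ⊆ parallelPlane Γ i → T ⊆ subgroupPlane g (H h) →
      Collinear H T := by
    intro i g h hh h1 h2
    refine Or.inr ⟨i, g, h, hh, fun p hp => ?_⟩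
    rcases p with q | k
    · exact ⟨q, rfl, h1 hp, h2 hp⟩
    · exact (h2 hp).elim
  have hTS : ∀ g f g' K, T ⊆ trianglePlane g f → T ⊆ subgroupPlane g' K → Collinear H T := by
    intro g f g' K h1 h2
    refine Or.inl ⟨g, fun p hp => ?_⟩
    rcases p with q | k
    · exact ⟨q, rfl, h1 hp⟩
    · exact (h2 hp).elim
  rcases hP with ⟨i, rfl⟩ | ⟨g, f, rfl⟩ | ⟨g, h, hh, rfl⟩ <;>
    rcases hQ with ⟨i', rfl⟩ | ⟨g', f', rfl⟩ | ⟨g', h', hh', rfl⟩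
  · refine (hle (Sum.inr 0) (Sum.inr 1) fun p hp => ?_).elim
    rcases p with q | k
    · have e1 : q.1 = i := hTP hp
      have e2 : q.1 = i' := hTQ hp
      exact absurd (by rw [← e1, e2]) hPQ
    · fin_cases k <;> simp
  · exact (hPT _ _ _ hTP hTQ).elim
  · exact hPS _ _ _ hh' hTP hTQ
  · exact (hPT _ _ _ hTQ hTP).elim
  -- Two triangle planes: if the common triple contains the extra point, then its two edges lie in
  -- different classes and determine the triangle, so the planes are equal.
  · by_cases hf : Sum.inr f ∈ T
    · exfalso
      have hff : f = f' := hTQ hf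
      subst hff
      have hcard : (T \ {Sum.inr f}).ncard = 2 := by
        rw [Set.ncard_sdiff_singleton_of_mem hf, hT]
      obtain ⟨p, p', hne, hpp⟩ := Set.ncard_eq_two.1 hcard
      have hp : p ∈ T \ {Sum.inr f} := by rw [hpp]; simp
      have hp' : p' ∈ T \ {Sum.inr f} := by rw [hpp]; simp
      rcases p with q | k
      · rcases p' with q' | k'
        · have e1 : switchedGain g q = 1 := hTP hp.1
          have e2 : switchedGain g' q = 1 := hTQ hp.1
          have e3 : switchedGain g q' = 1 := hTP hp'.1
          have e4 : switchedGain g' q' = 1 := hTQ hp'.1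
          have hq : q.1 ≠ q'.1 := by
            intro hq
            refine hne (congrArg Sum.inl (Prod.ext hq ?_))
            rw [switchedGain, mul_inv_eq_one] at e1 e3
            rw [← hq, ← e1] at e3
            exact (mul_left_cancel e3).symm
          obtain ⟨c, hc⟩ := switchedGain_conj hq e1 e2 e3 e4
          refine hPQ (Set.ext fun r => ?_)
          rcases r with r | k
          · change switchedGain g r = 1 ↔ switchedGain g' r = 1
            rw [hc, conj_eq_one_iff]
          · exact Iff.rfl
        · exact hp'.2 (congrArg Sum.inr (hTP hp'.1 : k' = f))
      · exact hp.2 (congrArg Sum.inr (hTP hp.1 : k = f))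
    · refine Or.inl ⟨g, fun p hp => ?_⟩
      rcases p with q | k
      · exact ⟨q, rfl, hTP hp⟩
      · have e1 : k = f := hTP hp
        exact absurd (e1 ▸ hp) hf
  · exact hTS _ _ _ _ hTP hTQ
  · exact hPS _ _ _ hh hTQ hTP
  · exact hTS _ _ _ _ hTQ hTP
  -- Two subgroup planes: unless the triple lies in one class, both switchings can be chosen to
  -- balance the same two edges, and they then differ by a constant `c`.
  · by_cases hcls : ∀ q q', Sum.inl q ∈ T → Sum.inl q' ∈ T → q.1 = q'.1
    · obtain ⟨p, hp⟩ : T.Nonempty := Set.nonempty_of_ncard_ne_zero (by omega)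
      rcases p with q₀ | k
      · refine Or.inr ⟨q₀.1, g, h, hh, fun p' hp' => ?_⟩
        rcases p' with q | k
        · exact ⟨q, rfl, hcls q q₀ hp' hp, hTP hp'⟩
        · exact (hTP hp').elim
      · exact (hTP hp).elim
    · push Not at hcls
      obtain ⟨q, q', hq, hq', hne⟩ := hcls
      obtain ⟨g₁, e1, e2, e3⟩ := exists_switching_mem hne (hTP hq) (hTP hq')
      obtain ⟨g₂, e4, e5, e6⟩ := exists_switching_mem hne (hTQ hq) (hTQ hq')
      rw [← e3] at hTP hPQ
      rw [← e6] at hTQ hPQ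
      obtain ⟨c, hc⟩ := switchedGain_conj hne e1 e4 e2 e5
      by_cases hall : ∀ r, Sum.inl r ∈ T → switchedGain g₁ r = 1
      · refine Or.inl ⟨g₁, fun p hp => ?_⟩
        rcases p with r | k
        · exact ⟨r, rfl, hall r hp⟩
        · exact (hTP hp).elim
      -- An unbalanced third edge determines the part in each plane. The two parts correspond under
      -- conjugation by `c`, so by invariance the planes are equal.
      · exfalso
        push Not at hall
        obtain ⟨r, hr, hr1⟩ := hall
        have f1 : switchedGain g₁ r ∈ H h := hTP hr
        have f2 : switchedGain g₂ r ∈ H h' := hTQ hr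
        rw [hc] at f2
        rw [← hH.eq_of_mem f1 hr1, ← hH.eq_of_mem f2 (by rwa [Ne, conj_eq_one_iff])] at hPQ
        refine hPQ (Set.ext fun s => ?_)
        rcases s with s | k
        · change switchedGain g₁ s ∈ H (switchedGain g₁ r) ↔
            switchedGain g₂ s ∈ H (c * switchedGain g₁ r * c⁻¹)
          rw [hc]
          refine ⟨hconj c _ _, fun hs => ?_⟩
          have := hconj c⁻¹ _ _ hs
          simpa [mul_assoc] using this
        · exact Iff.rfl

theorem ncard_four {α : Type*} {a b c d : α} (hab : a ≠ b) (hac : a ≠ c) (had : a ≠ d)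
    (hbc : b ≠ c) (hbd : b ≠ d) (hcd : c ≠ d) : ({a, b, c, d} : Set α).ncard = 4 := by
  rw [Set.ncard_insert_of_notMem (by simp [hab, hac, had]),
    Set.ncard_insert_of_notMem (by simp [hbc, hbd]), Set.ncard_pair hcd]

theorem not_coplanar_of_ne {q q' : Fin 3 × Γ} (hne : q.1 ≠ q'.1) :
    ¬ Coplanar H {Sum.inl q, Sum.inl q', Sum.inr 0, Sum.inr 1} := by
  rintro ⟨P, ⟨i, rfl⟩ | ⟨g, f, rfl⟩ | ⟨g, h, hh, rfl⟩, hS⟩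
  · have e1 : q.1 = i := hS (Or.inl rfl)
    have e2 : q'.1 = i := hS (Or.inr (Or.inl rfl))
    exact hne (e1.trans e2.symm)
  · have e1 : (0 : Fin 2) = f := hS (Or.inr (Or.inr (Or.inl rfl)))
    have e2 : (1 : Fin 2) = f := hS (Or.inr (Or.inr (Or.inr rfl)))
    exact absurd (e1.trans e2.symm) (by decide)
  · exact hS (Or.inr (Or.inr (Or.inl rfl)))

/-- The matroid of rank four whose bases are the non-coplanar sets of four points. -/
def planeMatroid [Finite Γ] (hH : IsPartitionMap H)
    (hconj : ∀ g x y, y ∈ H x → g * y * g⁻¹ ∈ H (g * x * g⁻¹)) : Matroid ((Fin 3 × Γ) ⊕ Fin 2) :=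
  Matroid.ofIsBaseOfFinite (E := Set.univ) Set.finite_univ
    (fun B => B.ncard = 4 ∧ ¬ Coplanar H B)
    ⟨{Sum.inl (0, 1), Sum.inl (1, 1), Sum.inr 0, Sum.inr 1},
      ncard_four (by simp) (by simp) (by simp) (by simp) (by simp) (by simp),
      not_coplanar_of_ne (by simp)⟩
    (by
      rintro B B' ⟨hB, hBc⟩ ⟨hB', hBc'⟩ x ⟨hxB, hxB'⟩
      have hT : (B \ {x}).ncard = 3 := by rw [Set.ncard_sdiff_singleton_of_mem hxB, hB]
      -- Two different planes through `B \ {x}` would make it collinear, and then `B` would be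
      -- coplanar.
      have huniq : ∀ P Q, IsPlane H P → IsPlane H Q → B \ {x} ⊆ P → B \ {x} ⊆ Q → P = Q := by
        intro P Q hP hQ hTP hTQ
        by_contra hPQ
        refine hBc ?_
        have := hH.coplanar_insert
          (hH.collinear_of_subset_of_subset hconj hT hP hQ hPQ hTP hTQ) x
        rwa [Set.insert_sdiff_singleton, Set.insert_eq_of_mem hxB] at this
      -- If the triple lies in a plane, any point of `B'` off that plane works, since the plane is
      -- unique; if it lies in none, any new point of `B'` works.
      have hfind : ∃ y ∈ B', y ∉ B \ {x} ∧ ¬ Coplanar H (insert y (B \ {x})) := by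
        by_cases hc : Coplanar H (B \ {x})
        · obtain ⟨P, hP, hTP⟩ := hc
          obtain ⟨y, hy, hyP⟩ := Set.not_subset.1 fun h => hBc' ⟨P, hP, h⟩
          refine ⟨y, hy, fun h => hyP (hTP h), ?_⟩
          rintro ⟨Q, hQ, hTQ⟩
          rw [Set.insert_subset_iff] at hTQ
          exact hyP (huniq P Q hP hQ hTP hTQ.2 ▸ hTQ.1)
        · obtain ⟨y, hy, hyT⟩ := Set.exists_mem_notMem_of_ncard_lt_ncard
            (by omega : (B \ {x}).ncard < B'.ncard)
          refine ⟨y, hy, hyT, ?_⟩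
          rintro ⟨Q, hQ, hTQ⟩
          exact hc ⟨Q, hQ, (Set.subset_insert _ _).trans hTQ⟩
      obtain ⟨y, hy, hyT, hyc⟩ := hfind
      refine ⟨y, ⟨hy, fun hyB => hyT ⟨hyB, ?_⟩⟩, ?_, hyc⟩
      · rintro rfl
        exact hxB' hy
      · rw [Set.ncard_insert_of_notMem hyT, hT])
    (fun _ _ => Set.subset_univ _)

end Geometry

/-! ### Independent sets of the rank-four matroid -/

section PlaneMatroid

variable {Γ : Type u} [Group Γ] [Finite Γ] {H : Γ → Subgroup Γ} {hH : IsPartitionMap H}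
  {hconj : ∀ g x y, y ∈ H x → g * y * g⁻¹ ∈ H (g * x * g⁻¹)}

theorem planeMatroid_indep_iff {I : Set ((Fin 3 × Γ) ⊕ Fin 2)} :
    (planeMatroid hH hconj).Indep I ↔ ∃ B, (B.ncard = 4 ∧ ¬ Coplanar H B) ∧ I ⊆ B := by
  rw [Matroid.indep_iff]
  rfl

theorem planeMatroid_indep_of_ne {q q' : Fin 3 × Γ} (hne : q.1 ≠ q'.1) :
    (planeMatroid hH hconj).Indep {Sum.inl q, Sum.inl q', Sum.inr 0, Sum.inr 1} := by
  have hqq : q ≠ q' := fun h => hne (congrArg Prod.fst h)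
  exact planeMatroid_indep_iff.2 ⟨_, ⟨ncard_four (by simpa using hqq) (by simp) (by simp) (by simp)
    (by simp) (by simp), not_coplanar_of_ne hne⟩, subset_rfl⟩

/-- This describes the contraction of the two further points; it matches the acyclic sets on three
vertices in `isAcyclicSet_three_iff`. -/
theorem planeMatroid_indep_union_iff {J : Set (Fin 3 × Γ)} :
    (planeMatroid hH hconj).Indep (Sum.inl '' J ∪ Set.range Sum.inr) ↔
      Set.InjOn Prod.fst J ∧ J.ncard ≤ 2 := by
  have hrange : Set.range (Sum.inr : Fin 2 → (Fin 3 × Γ) ⊕ Fin 2) = {Sum.inr 0, Sum.inr 1} := by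
    ext p
    simp [Fin.exists_fin_two, eq_comm]
  rw [hrange]
  constructor
  · intro h
    obtain ⟨B, ⟨hB, hBc⟩, hsub⟩ := planeMatroid_indep_iff.1 h
    constructor
    · intro q hq q' hq' hfst
      by_contra hne
      have h4 : ({Sum.inl q, Sum.inl q', Sum.inr 0, Sum.inr 1} :
          Set ((Fin 3 × Γ) ⊕ Fin 2)).ncard = 4 :=
        ncard_four (by simpa using hne) (by simp) (by simp) (by simp) (by simp) (by simp)
      have heq : ({Sum.inl q, Sum.inl q', Sum.inr 0, Sum.inr 1} :
          Set ((Fin 3 × Γ) ⊕ Fin 2)) = B := by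
        refine Set.eq_of_subset_of_ncard_le ?_ (by omega) (Set.toFinite _)
        rintro p (rfl | rfl | rfl | rfl)
        · exact hsub (Or.inl ⟨q, hq, rfl⟩)
        · exact hsub (Or.inl ⟨q', hq', rfl⟩)
        · exact hsub (Or.inr (by simp))
        · exact hsub (Or.inr (by simp))
      refine hBc ⟨_, Or.inl ⟨q.1, rfl⟩, ?_⟩
      rw [← heq]
      rintro p (rfl | rfl | rfl | rfl)
      exacts [rfl, hfst.symm, trivial, trivial]
    · have h1 := Set.ncard_le_ncard hsub (Set.toFinite _)
      rw [Set.ncard_union_eq (by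
        rw [Set.disjoint_left]
        rintro _ ⟨q, -, rfl⟩ hq
        simp at hq) (Set.toFinite _) (Set.toFinite _),
        Set.ncard_image_of_injective _ Sum.inl_injective, Set.ncard_pair (by simp)] at h1
      omega
  · rintro ⟨hinj, hcard⟩
    obtain ⟨q, q', hne, hJ⟩ : ∃ q q' : Fin 3 × Γ, q.1 ≠ q'.1 ∧ J ⊆ {q, q'} := by
      rcases (by omega : J.ncard = 0 ∨ J.ncard = 1 ∨ J.ncard = 2) with h | h | h
      · rw [Set.ncard_eq_zero] at h
        exact ⟨(0, 1), (1, 1), by simp, by simp [h]⟩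
      · obtain ⟨q, rfl⟩ := Set.ncard_eq_one.1 h
        exact ⟨q, (q.1 + 1, 1), (fin_three_add_one_ne q.1).symm, by simp⟩
      · obtain ⟨q, q', hne, rfl⟩ := Set.ncard_eq_two.1 h
        exact ⟨q, q', fun hfst => hne (hinj (by simp) (by simp) hfst), subset_rfl⟩
    refine (planeMatroid_indep_of_ne hne).subset ?_
    rintro p (⟨r, hr, rfl⟩ | rfl | rfl)
    · rcases hJ hr with rfl | rfl <;> simp
    · simp
    · simp

theorem planeMatroid_indep_pair (q q' : Fin 3 × Γ) :
    (planeMatroid hH hconj).Indep {Sum.inl q, Sum.inl q'} := by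
  by_cases hfst : q.1 = q'.1
  · by_cases hqq : q = q'
    · subst hqq
      refine (planeMatroid_indep_of_ne (fin_three_add_one_ne q.1).symm
        (q' := (q.1 + 1, 1))).subset ?_
      rintro p (rfl | rfl) <;> simp
    have h1 := fin_three_add_one_ne q.1
    -- The edge of another class excludes parallel planes, the two distinct parallel edges exclude
    -- triangle planes, and the extra point excludes subgroup planes.
    refine planeMatroid_indep_iff.2 ⟨{Sum.inl q, Sum.inl q', Sum.inl (q.1 + 1, 1), Sum.inr 0},
      ⟨ncard_four (by simpa using hqq) ?_ (by simp) ?_ (by simp) (by simp), ?_⟩, ?_⟩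
    · intro h
      exact h1 (congrArg Prod.fst (Sum.inl_injective h)).symm
    · intro h
      exact h1 (hfst.trans (congrArg Prod.fst (Sum.inl_injective h))).symm
    · rintro ⟨P, ⟨i, rfl⟩ | ⟨g, f, rfl⟩ | ⟨g, h, hh, rfl⟩, hS⟩
      · have e1 : q.1 = i := hS (Or.inl rfl)
        have e2 : q.1 + 1 = i := hS (Or.inr (Or.inr (Or.inl rfl)))
        exact h1 (e2.trans e1.symm)
      · have e1 : switchedGain g q = 1 := hS (Or.inl rfl)
        have e2 : switchedGain g q' = 1 := hS (Or.inr (Or.inl rfl))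
        rw [switchedGain, mul_inv_eq_one] at e1 e2
        rw [← hfst, ← e1] at e2
        exact hqq (Prod.ext hfst (mul_left_cancel e2).symm)
      · exact hS (Or.inr (Or.inr (Or.inr rfl)))
    · rintro p (rfl | rfl) <;> simp
  · exact (planeMatroid_indep_of_ne hfst).subset (by rintro p (rfl | rfl) <;> simp)

theorem planeMatroid_indep_triangle_iff {x : Fin 3 → Γ} :
    (planeMatroid hH hconj).Indep {Sum.inl (0, x 0), Sum.inl (1, x 1), Sum.inl (2, x 2)} ↔
      x 0 * x 1 * x 2 ≠ 1 := by
  constructor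
  · intro h hx
    obtain ⟨B, ⟨hB, hBc⟩, hsub⟩ := planeMatroid_indep_iff.1 h
    set T : Set ((Fin 3 × Γ) ⊕ Fin 2) := {Sum.inl (0, x 0), Sum.inl (1, x 1), Sum.inl (2, x 2)}
    have hT : T.ncard = 3 := by
      rw [Set.ncard_insert_of_notMem (by simp), Set.ncard_pair (by simp)]
    obtain ⟨y, hy⟩ : ∃ y, B = insert y T := by
      obtain ⟨y, hyB, hyT⟩ := Set.exists_mem_notMem_of_ncard_lt_ncard (by omega : T.ncard < B.ncard)
      refine ⟨y, (Set.eq_of_subset_of_ncard_le (Set.insert_subset hyB hsub) ?_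
        (Set.toFinite _)).symm⟩
      rw [Set.ncard_insert_of_notMem hyT]
      omega
    -- The partial products of the gains form a switching that balances the triangle, so it is
    -- collinear and no fourth point makes a base.
    refine hBc (hy ▸ hH.coplanar_insert (Or.inl ⟨![1, x 0, x 0 * x 1], ?_⟩) y)
    rintro p (rfl | rfl | rfl)
    · exact ⟨_, rfl, by simp [switchedGain]⟩
    · exact ⟨_, rfl, by simp [switchedGain]⟩
    · refine ⟨_, rfl, ?_⟩
      change x 0 * x 1 * x 2 * 1⁻¹ = 1
      rw [hx, inv_one, mul_one]
  · intro hx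
    refine planeMatroid_indep_iff.2
      ⟨{Sum.inl (0, x 0), Sum.inl (1, x 1), Sum.inl (2, x 2), Sum.inr 0},
        ⟨ncard_four (by simp) (by simp) (by simp) (by simp) (by simp) (by simp), ?_⟩, ?_⟩
    · rintro ⟨P, ⟨i, rfl⟩ | ⟨g, f, rfl⟩ | ⟨g, h, hh, rfl⟩, hS⟩
      · have e1 : (0 : Fin 3) = i := hS (Or.inl rfl)
        have e2 : (1 : Fin 3) = i := hS (Or.inr (Or.inl rfl))
        exact absurd (e1.trans e2.symm) (by decide)
      · have e1 : g 0 * x 0 * (g 1)⁻¹ = 1 := hS (Or.inl rfl)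
        have e2 : g 1 * x 1 * (g 2)⁻¹ = 1 := hS (Or.inr (Or.inl rfl))
        have e3 : g 2 * x 2 * (g 0)⁻¹ = 1 := hS (Or.inr (Or.inr (Or.inl rfl)))
        rw [mul_inv_eq_one] at e1 e2 e3
        refine hx (mul_left_cancel (a := g 0) ?_)
        rw [← mul_assoc, ← mul_assoc, e1, e2, e3, mul_one]
      · exact hS (Or.inr (Or.inr (Or.inr rfl)))
    · rintro p (rfl | rfl | rfl) <;> simp

theorem planeMatroid_indep_parallel {x y : Γ} (hx : x ≠ 1) (hy : y ≠ 1) (hxy : y ∉ H x) :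
    (planeMatroid hH hconj).Indep {Sum.inl (0, y), Sum.inl (0, x), Sum.inl (0, 1)} := by
  have hne : y ≠ x := by
    rintro rfl
    exact hxy (hH.mem_self y)
  refine planeMatroid_indep_iff.2
    ⟨{Sum.inl (0, y), Sum.inl (0, x), Sum.inl (0, 1), Sum.inl (1, 1)},
      ⟨ncard_four (by simpa using hne) (by simpa using hy) (by simp) (by simpa using hx) (by simp)
        (by simp), ?_⟩, ?_⟩
  · rintro ⟨P, ⟨i, rfl⟩ | ⟨g, f, rfl⟩ | ⟨g, h, hh, rfl⟩, hS⟩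
    · have e1 : (0 : Fin 3) = i := hS (Or.inl rfl)
      have e2 : (1 : Fin 3) = i := hS (Or.inr (Or.inr (Or.inr rfl)))
      exact absurd (e1.trans e2.symm) (by decide)
    · have e1 : g 0 * y * (g 1)⁻¹ = 1 := hS (Or.inl rfl)
      have e2 : g 0 * x * (g 1)⁻¹ = 1 := hS (Or.inr (Or.inl rfl))
      exact hne (mul_left_cancel (mul_right_cancel (e1.trans e2.symm)))
    · have e1 : g 0 * y * (g 1)⁻¹ ∈ H h := hS (Or.inl rfl)
      have e2 : g 0 * x * (g 1)⁻¹ ∈ H h := hS (Or.inr (Or.inl rfl))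
      have e3 : g 0 * 1 * (g 1)⁻¹ ∈ H h := hS (Or.inr (Or.inr (Or.inl rfl)))
      -- Dividing by the label of gain `1` puts the conjugates of `y` and `x` by `g 0` in one part;
      -- invariance then puts `y` in the part of `x`.
      have f1 := mul_mem e1 (inv_mem e3)
      have f2 := mul_mem e2 (inv_mem e3)
      rw [show g 0 * y * (g 1)⁻¹ * (g 0 * 1 * (g 1)⁻¹)⁻¹ = g 0 * y * (g 0)⁻¹ by group] at f1
      rw [show g 0 * x * (g 1)⁻¹ * (g 0 * 1 * (g 1)⁻¹)⁻¹ = g 0 * x * (g 0)⁻¹ by group] at f2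
      rw [← hH.eq_of_mem f2 (by rwa [Ne, conj_eq_one_iff])] at f1
      have := hconj (g 0)⁻¹ _ _ f1
      exact hxy (by simpa [mul_assoc] using this)
  · rintro p (rfl | rfl | rfl) <;> simp

end PlaneMatroid

/-! ### The lift of the full gain graph on three vertices -/

section ThreeVertices

variable {Γ : Type u} [Group Γ]

/-- The edge from `i` to `i + 1` with a given gain. -/
def cyclicEdge (q : Fin 3 × Γ) : GainEdge 3 Γ := gainEdge (fin_three_add_one_ne q.1).symm q.2

theorem cyclicEdge_bijective : Function.Bijective (cyclicEdge (Γ := Γ)) := by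
  constructor
  · rintro ⟨i, a⟩ ⟨j, b⟩ h
    have h1 := isLink_gainEdge (fin_three_add_one_ne i).symm a
    change (fullGainGraph 3 Γ).IsLink (cyclicEdge (i, a)) i (i + 1) at h1
    rw [h, cyclicEdge, isLink_gainEdge_iff] at h1
    obtain rfl : i = j := by
      clear h
      dsimp only at h1
      revert i j
      decide
    exact Prod.ext rfl (gainEdge_injective _ h)
  · intro e
    obtain ⟨i, j, hij, γ, -, rfl⟩ := exists_eq_gainEdge e
    rcases fin_three_adjacent hij with rfl | rfl
    · exact ⟨(i, γ), rfl⟩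
    · exact ⟨(j, γ⁻¹), gainEdge_symm hij γ⟩

/-- The class and the gain of an edge of the full gain graph on three vertices, with respect to the
cyclic orientation. -/
noncomputable def cyclicCode : GainEdge 3 Γ ≃ Fin 3 × Γ :=
  (Equiv.ofBijective cyclicEdge cyclicEdge_bijective).symm

theorem cyclicCode_cyclicEdge (q : Fin 3 × Γ) : cyclicCode (cyclicEdge q) = q :=
  (Equiv.ofBijective cyclicEdge cyclicEdge_bijective).symm_apply_apply q

theorem cyclicEdge_cyclicCode (e : GainEdge 3 Γ) : cyclicEdge (cyclicCode e) = e :=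
  (Equiv.ofBijective cyclicEdge cyclicEdge_bijective).apply_symm_apply e

theorem exists_parallel {e e' : GainEdge 3 Γ} (h : (cyclicCode e).1 = (cyclicCode e').1) :
    ∃ (i j : Fin 3) (hij : i ≠ j) (a b : Γ), e = gainEdge hij a ∧ e' = gainEdge hij b := by
  refine ⟨_, _, (fin_three_add_one_ne (cyclicCode e).1).symm, (cyclicCode e).2, (cyclicCode e').2,
    (cyclicEdge_cyclicCode e).symm, ?_⟩
  conv_lhs => rw [← cyclicEdge_cyclicCode e', cyclicEdge]
  congr 1 <;> simp [h]

theorem cyclicCode_eq_of_isLink {e e' : GainEdge 3 Γ} {x y : Fin 3}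
    (h : (fullGainGraph 3 Γ).IsLink e x y) (h' : (fullGainGraph 3 Γ).IsLink e' x y) :
    (cyclicCode e).1 = (cyclicCode e').1 := by
  rw [← cyclicEdge_cyclicCode e, cyclicEdge, isLink_gainEdge_iff] at h
  rw [← cyclicEdge_cyclicCode e', cyclicEdge, isLink_gainEdge_iff] at h'
  generalize (cyclicCode e).1 = i at h ⊢
  generalize (cyclicCode e').1 = j at h' ⊢
  revert i j x y
  decide

theorem isAcyclicSet_three_iff [Finite Γ] {I : Set (GainEdge 3 Γ)} :
    IsAcyclicSet (fullGainGraph 3 Γ) I ↔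
      Set.InjOn Prod.fst (cyclicCode '' I) ∧ (cyclicCode '' I).ncard ≤ 2 := by
  constructor
  · rintro ⟨-, hI⟩
    have hinj : Set.InjOn Prod.fst (cyclicCode '' I) := by
      rintro _ ⟨e, he, rfl⟩ _ ⟨e', he', rfl⟩ h
      by_contra hne
      obtain ⟨i, j, hij, a, b, rfl, rfl⟩ := exists_parallel h
      have hab : a ≠ b := by
        rintro rfl
        exact hne rfl
      refine hI _ ?_ ⟨1, _, _, isCyclicWalk_parallel hij hab, rfl⟩
      rw [range_pair]
      rintro f (rfl | rfl)
      exacts [he, he']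
    refine ⟨hinj, ?_⟩
    by_contra hcard
    -- Three edges of distinct classes meet every class and form a triangle.
    have huniv : Prod.fst '' (cyclicCode '' I) = Set.univ := by
      refine Set.eq_of_subset_of_ncard_le (Set.subset_univ _) ?_ (Set.toFinite _)
      rw [hinj.ncard_image, Set.ncard_univ, Nat.card_eq_fintype_card, Fintype.card_fin]
      omega
    have hex : ∀ i : Fin 3, ∃ γ : Γ, cyclicEdge (i, γ) ∈ I := by
      intro i
      have : i ∈ Prod.fst '' (cyclicCode '' I) := by rw [huniv]; trivial
      obtain ⟨_, ⟨e, he, rfl⟩, rfl⟩ := this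
      refine ⟨(cyclicCode e).2, ?_⟩
      change cyclicEdge (cyclicCode e) ∈ I
      rwa [cyclicEdge_cyclicCode]
    choose x hx using hex
    refine hI _ ?_ ⟨2, _, _, isCyclicWalk_triangle (fin_three_add_one_ne 0).symm
      (fin_three_add_one_ne 1).symm (fin_three_add_one_ne 2).symm (x 0) (x 1) (x 2), rfl⟩
    rw [range_triangle]
    rintro f (rfl | rfl | rfl)
    exacts [hx 0, hx 1, hx 2]
  · rintro ⟨hinj, hcard⟩
    refine ⟨Set.subset_univ _, ?_⟩
    rintro C hCI ⟨m, v, e, hw, rfl⟩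
    rw [Set.ncard_image_of_injective _ cyclicCode.injective] at hcard
    have h1 := (Set.ncard_le_ncard hCI (Set.toFinite _)).trans hcard
    rw [← Set.image_univ, Set.ncard_image_of_injective _ hw.edge_injective, Set.ncard_univ,
      Nat.card_eq_fintype_card, Fintype.card_fin] at h1
    have hm : m = 0 ∨ m = 1 := by omega
    rcases hm with rfl | rfl
    · exact not_isLink_self (hw.isLink 0)
    · have h2 := cyclicCode_eq_of_isLink (hw.isLink 0) (hw.isLink 1).symm
      have h3 := cyclicCode.injective
        (hinj ⟨_, hCI ⟨0, rfl⟩, rfl⟩ ⟨_, hCI ⟨1, rfl⟩, rfl⟩ h2)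
      exact absurd (hw.edge_injective h3) (by decide)

/-- The three edges of a cyclic walk through all vertices, and the condition that its gain is
trivial, in terms of the cyclic orientation. -/
theorem exists_gains_of_isCyclicWalk {v : Fin 3 → Fin 3} {e : Fin 3 → GainEdge 3 Γ}
    (hw : IsCyclicWalk (fullGainGraph 3 Γ) v e) : ∃ x : Fin 3 → Γ,
      Set.range e = {cyclicEdge (0, x 0), cyclicEdge (1, x 1), cyclicEdge (2, x 2)} ∧
      ((List.ofFn fun i => gainFrom (e i) (v i)).prod = 1 ↔ x 0 * x 1 * x 2 = 1) := by
  have hbij : Function.Bijective v := Finite.injective_iff_bijective.1 hw.vert_injective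
  have hrange : ∀ (x : Fin 3 → Γ), (∀ i, cyclicEdge (i, x i) ∈ Set.range e) →
      Set.range e = {cyclicEdge (0, x 0), cyclicEdge (1, x 1), cyclicEdge (2, x 2)} := by
    intro x hx
    have hinj := (cyclicEdge_bijective (Γ := Γ)).1
    symm
    refine Set.eq_of_subset_of_ncard_le ?_ ?_ (Set.finite_range e)
    · rintro f (rfl | rfl | rfl)
      exacts [hx 0, hx 1, hx 2]
    · rw [← Set.image_univ, Set.ncard_image_of_injective _ hw.edge_injective, Set.ncard_univ,
        Nat.card_eq_fintype_card, Fintype.card_fin, Set.ncard_insert_of_notMem, Set.ncard_pair]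
      · exact fun h => absurd (congrArg Prod.fst (hinj h)) (by decide : (1 : Fin 3) ≠ 2)
      · rintro (h | h)
        · exact absurd (congrArg Prod.fst (hinj h)) (by decide : (0 : Fin 3) ≠ 1)
        · exact absurd (congrArg Prod.fst (hinj h)) (by decide : (0 : Fin 3) ≠ 2)
  -- Cyclic rotation conjugates the product, so its triviality does not depend on the starting
  -- vertex.
  have hrot : ∀ (x : Fin 3 → Γ) (i : Fin 3),
      x i * (x (i + 1) * x (i + 1 + 1)) = 1 ↔ x 0 * x 1 * x 2 = 1 := by
    intro x i
    have hcycle : ∀ a b : Γ, a * b = 1 ↔ b * a = 1 := fun a b => by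
      rw [mul_eq_one_iff_eq_inv, mul_eq_one_iff_inv_eq, eq_comm]
    have h1 : x 1 * (x 2 * x 0) = 1 ↔ x 0 * x 1 * x 2 = 1 := by
      rw [← mul_assoc, hcycle, mul_assoc]
    have h2 : x 2 * (x 0 * x 1) = 1 ↔ x 0 * x 1 * x 2 = 1 := by
      rw [hcycle]
    fin_cases i
    exacts [by rw [← mul_assoc]; rfl, h1, h2]
  -- A walk through all three vertices follows the cyclic orientation or its reverse; in the reverse
  -- case the gain product is inverted.
  have hdir : ∀ v : Fin 3 → Fin 3, Function.Injective v →
      (∀ i, v (i + 1) = v i + 1) ∨ ∀ i, v i = v (i + 1) + 1 := by decide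
  obtain ⟨w, hwv⟩ := hbij.1.hasLeftInverse
  have hvw : ∀ k, v (w k) = k := fun k => by
    obtain ⟨i, rfl⟩ := hbij.2 k
    rw [hwv]
  have hcode : ∀ (f : GainEdge 3 Γ) (k : Fin 3), (fullGainGraph 3 Γ).IsLink f k (k + 1) →
      f = cyclicEdge (k, (cyclicCode f).2) := by
    intro f k h
    have h2 : (cyclicCode f).1 = (cyclicCode (cyclicEdge (k, (1 : Γ)))).1 :=
      cyclicCode_eq_of_isLink h (isLink_gainEdge (fin_three_add_one_ne k).symm 1)
    rw [cyclicCode_cyclicEdge] at h2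
    exact (cyclicEdge_cyclicCode f).symm.trans (congrArg cyclicEdge (Prod.ext h2 rfl))
  rcases hdir v hw.vert_injective with hv | hv
  · obtain ⟨x, hx⟩ : ∃ x : Fin 3 → Γ, ∀ i, e i = cyclicEdge (v i, x (v i)) :=
      ⟨fun k => (cyclicCode (e (w k))).2, fun i => by
        dsimp only
        rw [hwv]
        exact hcode _ _ (hv i ▸ hw.isLink i)⟩
    refine ⟨x, hrange x fun k => ⟨w k, by rw [hx, hvw]⟩, ?_⟩
    have hg : ∀ i, gainFrom (e i) (v i) = x (v i) := fun i => by
      rw [hx i]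
      exact gainFrom_gainEdge _ _
    have h2 : v 2 = v 0 + 1 + 1 := by rw [← hv 0]; exact hv 1
    rw [← hrot x (v 0), ← h2, ← hv 0]
    simp only [List.ofFn_succ, List.ofFn_zero, List.prod_cons, List.prod_nil, mul_one, hg]
    exact Iff.rfl
  · obtain ⟨x, hx⟩ : ∃ x : Fin 3 → Γ, ∀ i, e i = cyclicEdge (v (i + 1), x (v (i + 1))) :=
      ⟨fun k => (cyclicCode (e (w k - 1))).2, fun i => by
        have h1 := (hw.isLink i).symm
        rw [hv i] at h1
        dsimp only
        rw [hwv, add_sub_cancel_right]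
        exact hcode _ _ h1⟩
    refine ⟨x, hrange x fun k => ⟨w k - 1, by rw [hx, sub_add_cancel, hvw]⟩, ?_⟩
    have hg : ∀ i, gainFrom (e i) (v i) = (x (v (i + 1)))⁻¹ := fun i => by
      rw [hx i, cyclicEdge, ← gainEdge_symm, hv i]
      exact gainFrom_gainEdge _ _
    have h2 : v 2 = v 0 + 1 := hv 2
    have h1 : v 1 = v 0 + 1 + 1 := by rw [← h2]; exact hv 1
    rw [← hrot x (v 0), ← h1, ← h2, ← mul_assoc,
      ← inv_eq_one (a := x (v 0) * x (v 2) * x (v 1)), mul_inv_rev, mul_inv_rev]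
    simp only [List.ofFn_succ, List.ofFn_zero, List.prod_cons, List.prod_nil, mul_one, hg]
    exact Iff.rfl

end ThreeVertices

/-! ### The non-elementary lift on three vertices -/

section PlaneLift

variable {Γ : Type u} [Group Γ] [Finite Γ] {H : Γ → Subgroup Γ} (hH : IsPartitionMap H)
  (hconj : ∀ g x y, y ∈ H x → g * y * g⁻¹ ∈ H (g * x * g⁻¹))

/-- The lift of the full gain graph on three vertices defined by a partition map. -/
noncomputable def planeLift : Matroid (GainEdge 3 Γ) :=
  ((planeMatroid hH hconj).comap (Sum.map cyclicCode id)).comap Sum.inl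

variable {hH hconj}

theorem planeLift_indep_iff {I : Set (GainEdge 3 Γ)} :
    (planeLift hH hconj).Indep I ↔
      (planeMatroid hH hconj).Indep (Sum.inl '' (cyclicCode '' I)) := by
  rw [planeLift, Matroid.comap_indep_iff, Matroid.comap_indep_iff,
    and_iff_left Sum.inl_injective.injOn,
    and_iff_left (cyclicCode.injective.sumMap Function.injective_id).injOn, Set.image_image,
    Set.image_image]
  rfl

theorem isLift_planeLift : IsLift (planeLift hH hconj) (cycleMatroid (fullGainGraph 3 Γ)) := by
  have himage : ∀ I : Set (GainEdge 3 Γ), Sum.map cyclicCode id ''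
      (Sum.inl '' I ∪ Set.range (Sum.inr : Fin 2 → _)) =
      Sum.inl '' (cyclicCode '' I) ∪ Set.range Sum.inr := by
    intro I
    rw [Set.image_union, Set.image_image, Set.image_image, ← Set.range_comp]
    rfl
  have hinj := cyclicCode.injective.sumMap (Function.injective_id (α := Fin 2)) (α := GainEdge 3 Γ)
  have hind : ∀ I : Set (GainEdge 3 Γ), (cycleMatroid (fullGainGraph 3 Γ)).Indep I ↔
      ((planeMatroid hH hconj).comap (Sum.map cyclicCode id)).Indep
        (Sum.inl '' I ∪ Set.range Sum.inr) := by
    intro I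
    rw [cycleMatroid_indep_iff, Matroid.comap_indep_iff, and_iff_left hinj.injOn, himage,
      planeMatroid_indep_union_iff, isAcyclicSet_three_iff]
  refine isLift_comap_inl rfl ?_ hind rfl
  have h := (hind ∅).1 (Matroid.empty_indep _)
  rwa [Set.image_empty, Set.empty_union] at h

/-- Every pair of edges is independent, so no two-edge cycle is a circuit, and a triangle is a
circuit as soon as it is dependent, that is, balanced. -/
theorem planeLift_mem_balancedLifts : planeLift hH hconj ∈ balancedLifts 3 Γ := by
  have hpair : ∀ e e' : GainEdge 3 Γ, (planeLift hH hconj).Indep {e, e'} := by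
    intro e e'
    rw [planeLift_indep_iff, Set.image_pair, Set.image_pair]
    exact planeMatroid_indep_pair _ _
  refine ⟨isLift_planeLift, fun C hC => ?_⟩
  obtain ⟨m, v, e, hw, rfl⟩ := hC
  have hm : m = 0 ∨ m = 1 ∨ m = 2 := by
    have := Fintype.card_le_of_injective v hw.vert_injective
    simp only [Fintype.card_fin] at this
    omega
  have hrange : ∀ {k : ℕ} {u : Fin (k + 1) → Fin 3} {f : Fin (k + 1) → GainEdge 3 Γ},
      IsCyclicWalk (fullGainGraph 3 Γ) u f → Set.range f = Set.range e → k = m := by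
    intro k u f hf h
    have h1 := congrArg Set.ncard h
    rw [← Set.image_univ, ← Set.image_univ, Set.ncard_image_of_injective _ hf.edge_injective,
      Set.ncard_image_of_injective _ hw.edge_injective] at h1
    simpa using h1
  rcases hm with rfl | rfl | rfl
  · exact (not_isLink_self (hw.isLink 0)).elim
  · have he : Set.range e = {e 0, e 1} := by
      ext f
      simp [Fin.exists_fin_two, eq_comm]
    have hcls := cyclicCode_eq_of_isLink (hw.isLink 0) (hw.isLink 1).symm
    obtain ⟨i, j, hij, a, b, ha, hb⟩ := exists_parallel hcls
    have hab : a ≠ b := by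
      rintro rfl
      exact absurd (hw.edge_injective (ha.trans hb.symm)) (by decide)
    refine iff_of_false (fun h => h.not_indep (he ▸ hpair _ _)) ?_
    rw [he, ha, hb]
    exact not_isBalancedCycle_parallel hij hab
  · obtain ⟨x, hx, hprod⟩ := exists_gains_of_isCyclicWalk hw
    -- The edge set determines the three cyclic gains, so every traversal of the triangle gives the
    -- same condition.
    have hbal : IsBalancedCycle (Set.range e) ↔ x 0 * x 1 * x 2 = 1 := by
      refine ⟨?_, fun h => ⟨2, v, e, hw, rfl, hprod.2 h⟩⟩
      rintro ⟨m, v', e', hw', he, hp⟩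
      obtain rfl := hrange hw' he.symm
      obtain ⟨x', hx', hprod'⟩ := exists_gains_of_isCyclicWalk hw'
      have hmem : ∀ k, cyclicEdge (k, x' k) ∈ Set.range e := by
        intro k
        rw [he, hx']
        fin_cases k <;> simp
      have hxx : ∀ k, x' k = x k := by
        intro k
        have h1 := hmem k
        rw [hx] at h1
        have hinj := (cyclicEdge_bijective (Γ := Γ)).1
        rcases h1 with h1 | h1 | h1 <;>
        · have h2 := hinj h1
          have h3 := congrArg Prod.fst h2
          dsimp only at h3
          subst h3
          exact congrArg Prod.snd h2
      rw [← hxx, ← hxx, ← hxx]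
      exact hprod'.1 hp
    have hI : (planeLift hH hconj).Indep (Set.range e) ↔ x 0 * x 1 * x 2 ≠ 1 := by
      rw [planeLift_indep_iff, hx, ← planeMatroid_indep_triangle_iff (hH := hH) (hconj := hconj)]
      simp only [Set.image_insert_eq, Set.image_singleton, cyclicCode_cyclicEdge]
    rw [hbal]
    constructor
    · intro h
      by_contra hne
      exact h.not_indep (hI.2 hne)
    · intro h
      rw [Matroid.isCircuit_iff_dep_forall_sdiff_singleton_indep]
      refine ⟨⟨fun h' => hI.1 h' h, Set.subset_univ _⟩, ?_⟩
      rw [hx]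
      rintro f (rfl | rfl | rfl)
      · refine (hpair (cyclicEdge (1, x 1)) (cyclicEdge (2, x 2))).subset ?_
        rintro f' ⟨rfl | rfl | rfl, hf⟩ <;> simp_all
      · refine (hpair (cyclicEdge (0, x 0)) (cyclicEdge (2, x 2))).subset ?_
        rintro f' ⟨rfl | rfl | rfl, hf⟩ <;> simp_all
      · refine (hpair (cyclicEdge (0, x 0)) (cyclicEdge (1, x 1))).subset ?_
        rintro f' ⟨rfl | rfl | rfl, hf⟩ <;> simp_all

theorem exists_nonelementary_of_hasNontrivialGroupPartition
    (h : HasNontrivialGroupPartition Γ) : ∃ L ∈ balancedLifts 3 Γ,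
      ¬ IsElementaryLift L (cycleMatroid (fullGainGraph 3 Γ)) := by
  obtain ⟨H, hH, ⟨a, b, ha, hb, hab⟩, hconj⟩ := h.exists_conj_invariant
  refine ⟨planeLift hH hconj, planeLift_mem_balancedLifts,
    not_isElementaryLift_of_indep planeLift_mem_balancedLifts (fin_three_add_one_ne 0).symm ha hb
      ?_ ?_⟩
  · rintro rfl
    exact hab (hH.mem_self a)
  · have h1 : ∀ γ : Γ, cyclicCode (gainEdge (fin_three_add_one_ne 0).symm γ) = (0, γ) :=
      fun γ => cyclicCode_cyclicEdge (0, γ)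
    rw [planeLift_indep_iff, Set.image_insert_eq, Set.image_pair, Set.image_insert_eq,
      Set.image_pair, h1, h1, h1]
    exact planeMatroid_indep_parallel ha hb hab

end PlaneLift

end LiftMatroid

/-! ### The characterisation -/

theorem theorem1p6 {Γ : Type*} [Group Γ] [Finite Γ] [Nontrivial Γ] (n : ℕ) (hn : 3 ≤ n) :
    (∃ L ∈ LiftMatroid.balancedLifts n Γ,
        ¬ LiftMatroid.IsElementaryLift L
          (LiftMatroid.cycleMatroid (LiftMatroid.fullGainGraph n Γ))) ↔
      (n = 3 ∧ LiftMatroid.HasNontrivialGroupPartition Γ) ∨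
      (4 ≤ n ∧ ∃ p j : ℕ, p.Prime ∧ 2 ≤ j ∧
        Nonempty (Γ ≃* Multiplicative (Fin j → ZMod p))) := by
  constructor
  · rintro ⟨L, hL, hne⟩
    rcases (by omega : n = 3 ∨ 4 ≤ n) with h | h
    · exact Or.inl
        ⟨h, LiftMatroid.hasNontrivialGroupPartition_of_not_isElementaryLift hn hL hne⟩
    · exact Or.inr ⟨h, LiftMatroid.exists_mulEquiv_of_not_isElementaryLift h hL hne⟩
  · rintro (⟨rfl, h⟩ | ⟨h, p, j, hp, hj, ⟨φ⟩⟩)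
    · exact LiftMatroid.exists_nonelementary_of_hasNontrivialGroupPartition h
    · exact LiftMatroid.exists_nonelementary_of_mulEquiv (by omega) hp hj φ
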